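/- \textbf{Theorem (The Nesting Theorem).} Let $F$ be any field, let $v_1,\dots,v_n\in F^r$ be vectors, and let $M$ be the matroid on $E=\{1,\dots,n\}$ that they represent ($A\subseteq E$ is independent iff $(v_i)_{i\in A}$ is linearly independent), with rank function $r(\cdot)$. Let $d>1$ be an integer. Define the following collections of subsets of $E$. \begin{itemize} \item \emph{Laman complex} $\mathcal L^d(M)$: all $A\subseteq E$ such that $d\cdot r(A')>|A'|$ for every nonempty $A'\subseteq A$. \item \emph{Rigidity complex} $\mathcal R^d(M)$: let $\varphi$ be the $d\times r$ matrix whose entries are $dr$ independent transcendentals over $F$. Then $\mathcal R^d(M)$ consists of all $A$ such that the vectors $v_i\otimes\varphi(v_i)\in F^r\otimes_F F(\varphi)^d$, $i\in A$, are linearly independent over $F(\varphi)$. \item \emph{Hyperplane-marking complex} $\mathcal H^d(M)$: adjoin $(d-1)n$ further independent transcendentals, the first $d-1$ coordinates of vectors $\eta_1,\dots,\eta_n$, and (when $v_i\ne0$) let the last coordinate of $\eta_i$ be determined by $\sum_{j=1}^d(\eta_i)_j\,\varphi(v_i)_j=0$, so that $\eta_i$ is a generic normal vector to $\varphi(v_i)$;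 when $v_i=0$, the last coordinate of $\eta_i$ is $0$ (this choice is immaterial, as then $v_i\otimes\eta_i=0$). Then $\mathcal H^d(M)$ consists of all $A$ such that the vectors $v_i\otimes\eta_i\in F^r\otimes_F F(\varphi,\eta)^d$, $i\in A$, are linearly independent over $F(\varphi,\eta)$. \item \emph{Slope complex} $\mathcal S^{k,d}(M)$, for integers $0<k<d$: fix an infinite field $K\supseteq F$ (for instance $K=\overline F$, or $K=F$ if $F$ is infinite), and let $\mathrm{Gr}(k,K^d)$ be the Grassmannian of $k$-dimensional subspaces of $K^d$. Then $\mathcal S^{k,d}(M)$ consists of all $A\subseteq E$ such that the set of those $(W_i)_{i\in A}\in\mathrm{Gr}(k,K^d)^A$ for which some linear map $\phi:K^r\to K^d$ satisfies $0\neq\phi(v_i)\in W_i$ for all $i\in A$ is Zariski dense in $\mathrm{Gr}(k,K^d)^A$, the closed sets being the zero loci of families of multihomogeneous polynomials over $K$ in the Pl\"ucker coordinates of the factors. \end{itemize} Then, for every such $K$, $$\mathcal S^{1,d}(M)\subseteq\mathcal R^d(M)\subseteq\mathcal L^d(M)=\mathcal H^d(M)=\mathcal S^{d-1,d}(M).$$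 -/

import Mathlib

noncomputable section

namespace MatroidRigidity

open MvPolynomial

/-! ### Represented matroids -/

/-- The matroid on a finite ground set `ι` represented over the field `K` by the vectors
`w i`: a set of indices is independent iff the corresponding family of vectors is linearly
independent. (Zero vectors are loops, proportional vectors are parallel elements.) -/
def vectorMatroid (K : Type*) {ι V : Type*} [Field K] [AddCommGroup V] [Module K V] [Finite ι]
    (w : ι → V) : Matroid ι :=
  (IndepMatroid.ofFinite (E := Set.univ) Set.finite_univ (fun I => LinearIndepOn K w I)
    (linearIndepOn_empty K w)
    (fun _ _ hJ hIJ => hJ.mono hIJ)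
    (by
      intro I J hI hJ hlt
      by_contra! hcon
      have hsub : ∀ e ∈ J, w e ∈ Submodule.span K (w '' I) := by
        intro e he
        by_contra hne
        have heI : e ∉ I := fun h => hne (Submodule.subset_span ⟨e, h, rfl⟩)
        exact hcon e he heI (hI.insert hne)
      have hle : Submodule.span K (w '' J) ≤ Submodule.span K (w '' I) := by
        rw [Submodule.span_le]
        rintro _ ⟨e, he, rfl⟩
        exact hsub e he
      have key : ∀ S : Set ι, LinearIndepOn K w S →
          Module.finrank K (Submodule.span K (w '' S)) = S.ncard := by
        intro S hS
        have hfin : Fintype S := Fintype.ofFinite S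
        have h := finrank_span_eq_card (R := K) (b := fun i : S => w i) hS
        rw [← Nat.card_eq_fintype_card, Nat.card_coe_set_eq] at h
        rw [← h, Set.image_eq_range]
      have hfd : FiniteDimensional K (Submodule.span K (w '' I)) :=
        FiniteDimensional.span_of_finite K (Set.toFinite _)
      have := Submodule.finrank_mono hle
      rw [key I hI, key J hJ] at this
      omega)
    (fun _ _ => Set.subset_univ _)).matroid

/-- The simplicial complex of independent sets of a matroid. -/
def indepComplex {α : Type*} (M : Matroid α) : Set (Set α) := {A | M.Indep A}

/-! ### Laman independence -/

/-- The `m`-Laman complex of a matroid `M` (on a finite ground set) with rank function `r`: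
all `A ⊆ E` such that `m * r(A') > |A'|` for every nonempty `A' ⊆ A`. -/
def lamanComplex {α : Type*} [Finite α] (M : Matroid α) (m : ℝ) : Set (Set α) :=
  {A | A ⊆ M.E ∧ ∀ A' ⊆ A, A'.Nonempty → (A'.ncard : ℝ) < m * ((M.eRk A').toNat : ℝ)}

/-! ### Products of Grassmannians with the Zariski topology -/

/-- The (`K`-points of the) Grassmannian of `k`-planes in `K ^ d`. -/
def Gr (K : Type*) [Field K] (k d : ℕ) : Type _ :=
  {W : Submodule K (Fin d → K) // Module.finrank K W = k}

/-- The product of copies, indexed by `ι`, of the Grassmannian of `k`-planes in `K ^ d`.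
Its topology, defined below, is the Zariski topology and not a product topology. -/
def GrProd (ι K : Type*) [Field K] (k d : ℕ) : Type _ := ι → Gr K k d

/-- The Plücker coordinate, at the `k`-element set of columns enumerated by `S`, of a `k`-plane
`W` in `K ^ d` with respect to an ordered basis of `W`. -/
def plucker {K : Type*} [Field K] {k d : ℕ} {W : Submodule K (Fin d → K)}
    (b : Module.Basis (Fin k) K W) (S : Fin k ↪o Fin d) : K :=
  Matrix.det (Matrix.of fun a c : Fin k => (b a : Fin d → K) (S c))

/-- A polynomial in Plücker coordinates `x_{i,S}` (`i ∈ ι`) is multihomogeneous of multidegree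
`D` if it is homogeneous of degree `D i` in the `i`-th group of variables, for every `i`. -/
def IsMultihomogeneous {ι P K : Type*} [Field K] (f : MvPolynomial (ι × P) K) (D : ι →₀ ℕ) :
    Prop :=
  IsWeightedHomogeneous (fun p : ι × P => Finsupp.single p.1 1) f D

/-- The locus in a product of Grassmannians where a multihomogeneous polynomial in the Plücker
coordinates does not vanish. As a change of the bases only rescales each group of Plücker
coordinates, "for some bases" and "for all bases" mean the same for multihomogeneous `f`. -/
def nonvanishingLocus {ι K : Type*} [Field K] {k d : ℕ}
    (f : MvPolynomial (ι × (Fin k ↪o Fin d)) K) : Set (GrProd ι K k d) :=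
  {W | ∃ b : ∀ i, Module.Basis (Fin k) K (W i).1, eval (fun p => plucker (b p.1) p.2) f ≠ 0}

/-- The Zariski topology on a product of Grassmannians (as a subvariety of a product of
projective spaces, via the Plücker embeddings). -/
instance zariskiTopology (ι K : Type*) [Field K] (k d : ℕ) :
    TopologicalSpace (GrProd ι K k d) :=
  TopologicalSpace.generateFrom
    {U | ∃ (f : MvPolynomial (ι × (Fin k ↪o Fin d)) K) (D : ι →₀ ℕ),
      IsMultihomogeneous f D ∧ U = nonvanishingLocus f}

/-! ### Photos and slope independence -/

/-- A vector of `F ^ r`, regarded as a vector of `K ^ r` for an extension field `K` of `F`. -/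
def extendScalars {F : Type*} (K : Type*) [Field F] [Field K] [Algebra F K] {r : ℕ}
    (x : Fin r → F) : Fin r → K :=
  fun a => algebraMap F K (x a)

/-- The space of `k`-plane-marked `d`-photos, with coordinates in `K`, of the matroid represented
by the vectors `v i ∈ F ^ r`. -/
def photoSpace {F ι : Type*} (K : Type*) [Field F] [Field K] [Algebra F K] {r : ℕ} (k d : ℕ)
    (v : ι → Fin r → F) :
    Set (((Fin r → K) →ₗ[K] (Fin d → K)) × GrProd ι K k d) :=
  {p | ∀ i, p.1 (extendScalars K (v i)) ∈ (p.2 i).1}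

/-- The non-annihilating cellule of the photo space. -/
def nonAnnihilatingCellule {F ι : Type*} (K : Type*) [Field F] [Field K] [Algebra F K] {r : ℕ}
    (k d : ℕ) (v : ι → Fin r → F) :
    Set (((Fin r → K) →ₗ[K] (Fin d → K)) × GrProd ι K k d) :=
  {p | p ∈ photoSpace K k d v ∧ ∀ i, p.1 (extendScalars K (v i)) ≠ 0}

/-- `(k, d)`-slope independence: the projection of the non-annihilating cellule is Zariski dense
in the product of Grassmannians. -/
def SlopeIndependent {F ι : Type*} (K : Type*) [Field F] [Field K] [Algebra F K] {r : ℕ}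
    (k d : ℕ) (v : ι → Fin r → F) : Prop :=
  Dense (Prod.snd '' nonAnnihilatingCellule K k d v)

/-- The `(k, d)`-slope complex: all sets `A` of indices such that the restriction to `A` of the
represented matroid is `(k, d)`-slope independent. -/
def slopeComplex {F ι : Type*} (K : Type*) [Field F] [Field K] [Algebra F K] {r : ℕ}
    (k d : ℕ) (v : ι → Fin r → F) : Set (Set ι) :=
  {A | SlopeIndependent K k d (fun i : A => v i)}

/-! ### The rigidity matroid -/

/-- The field `F(φ)`: the extension of `F` by the `d * r` indeterminate entries of `φ`. -/
abbrev PhotoField (F : Type*) [Field F] (r d : ℕ) : Type _ :=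
  FractionRing (MvPolynomial (Fin d × Fin r) F)

/-- The generic `d × r` matrix `φ`. -/
def genericPhoto (F : Type*) [Field F] (r d : ℕ) :
    Matrix (Fin d) (Fin r) (PhotoField F r d) :=
  fun j a => algebraMap (MvPolynomial (Fin d × Fin r) F) _ (X (j, a))

/-- The `d`-rigidity matrix: its `i`-th row is the vector `v i ⊗ φ(v i)`, written in the standard
basis of `F ^ r ⊗ F(φ) ^ d`. -/
def rigidityMatrix {F ι : Type*} [Field F] {r : ℕ} (d : ℕ) (v : ι → Fin r → F) :
    Matrix ι (Fin r × Fin d) (PhotoField F r d) :=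
  fun i p => extendScalars (PhotoField F r d) (v i) p.1 *
    (genericPhoto F r d).mulVec (extendScalars (PhotoField F r d) (v i)) p.2

/-- The `d`-dimensional generic rigidity matroid. -/
def rigidityMatroid {F ι : Type*} [Field F] [Finite ι] {r : ℕ} (d : ℕ) (v : ι → Fin r → F) :
    Matroid ι :=
  vectorMatroid (PhotoField F r d) (rigidityMatrix d v).row

/-- The `d`-rigidity complex. -/
def rigidityComplex {F ι : Type*} [Field F] [Finite ι] {r : ℕ} (d : ℕ) (v : ι → Fin r → F) :
    Set (Set ι) :=
  indepComplex (rigidityMatroid d v)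

/-! ### The hyperplane-marking matroid -/

/-- The field `F(φ, η)`: the extension of `F` by `d * r` indeterminates `φ_{j,a}` and, for every
index `i`, by `d - 1` further indeterminates `η_{i,l}`. -/
abbrev MarkedField (F ι : Type*) [Field F] (r d : ℕ) : Type _ :=
  FractionRing (MvPolynomial ((Fin d × Fin r) ⊕ (ι × Fin (d - 1))) F)

/-- The image `φ(v i)` under the generic matrix `φ`, with coordinates in `F(φ, η)`. -/
def markedImage {F ι : Type*} [Field F] {r : ℕ} (d : ℕ) (v : ι → Fin r → F) (i : ι) :
    Fin d → MarkedField F ι r d :=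
  Matrix.mulVec
    (fun j a => algebraMap (MvPolynomial ((Fin d × Fin r) ⊕ (ι × Fin (d - 1))) F) _
      (X (Sum.inl (j, a))))
    (extendScalars (MarkedField F ι r d) (v i))

/-- The generic vector `η i` normal to `φ(v i)`: its first `d - 1` coordinates are independent
indeterminates, and its last coordinate is the one that makes it orthogonal to `φ(v i)` (the last
coordinate of `φ(v i)` is nonzero as soon as `v i` is). -/
def genericNormal {F ι : Type*} [Field F] {r : ℕ} (d : ℕ) (v : ι → Fin r → F) (i : ι) :
    Fin d → MarkedField F ι r d :=
  let η : Fin (d - 1) → MarkedField F ι r d := fun l =>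
    algebraMap (MvPolynomial ((Fin d × Fin r) ⊕ (ι × Fin (d - 1))) F) _ (X (Sum.inr (i, l)))
  fun j =>
    if h : (j : ℕ) < d - 1 then η ⟨j, h⟩
    else -(∑ l : Fin (d - 1), η l * markedImage d v i (Fin.castLE (Nat.sub_le d 1) l)) /
      markedImage d v i j

/-- The matrix whose `i`-th row is the vector `v i ⊗ η i`, written in the standard basis of
`F ^ r ⊗ F(φ, η) ^ d`. -/
def hyperplaneMatrix {F ι : Type*} [Field F] {r : ℕ} (d : ℕ) (v : ι → Fin r → F) :
    Matrix ι (Fin r × Fin d) (MarkedField F ι r d) :=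
  fun i p => extendScalars (MarkedField F ι r d) (v i) p.1 * genericNormal d v i p.2

/-- The `d`-dimensional generic hyperplane-marking matroid. -/
def hyperplaneMatroid {F ι : Type*} [Field F] [Finite ι] {r : ℕ} (d : ℕ) (v : ι → Fin r → F) :
    Matroid ι :=
  vectorMatroid (MarkedField F ι r d) (hyperplaneMatrix d v).row

/-- The complex of independent sets of the hyperplane-marking matroid. -/
def hyperplaneComplex {F ι : Type*} [Field F] [Finite ι] {r : ℕ} (d : ℕ) (v : ι → Fin r → F) :
    Set (Set ι) :=
  indepComplex (hyperplaneMatroid d v)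

end MatroidRigidity

end

/-!
All complexes in the theorem are governed by tensors `v i ⊗ y i` and one functional on them.

*Necessity of the Laman condition.* Suppose the tensors `v i ⊗ y i`, `i ∈ S`, are independent and
killed by the functional `x ⊗ y ↦ ⟨ψ x, y⟩` of a linear map `ψ` which is nonzero on some `v i`,
`i ∈ S`. They lie in a proper subspace of the `d * r(S)`-dimensional space spanned by the
`v i ⊗ e_j`, so `|S| < d * r(S)` (`card_lt_of_linearIndependent_tensorRow`). For the
hyperplane-marking matroid `ψ` is the generic matrix `φ`; for the rigidity matroid it is `J φ`, with
`J` alternating. For slope independence, `ψ` is a photo, and `y i` is a vector normal to the `i`-th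
marking whose coordinates are signed Plücker coordinates, chosen so that the `v i ⊗ y i` are
independent at some point and hence, the condition being open and multihomogeneous, at some photo
(`SlopeIndependent.isLaman`, valid for all `0 < k < d`).

*Colorings.* The point at which the tensors are independent comes from Rado's theorem
(`exists_transversal_linearIndependent`): if `|S| ≤ d * r(S)` for all `S`, then there is a coloring
`c` such that the `v i ⊗ e_{c i}` are independent (`exists_coloring`). It also shows that for
generic directions `y i` the tensors `v i ⊗ y i` are independent. If the directions can be prescribed
by a photo `φ`, they are proportional to `v i ⊗ φ (v i)`, so that the first slope complex is
contained in the rigidity complex.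

*Sufficiency of the Laman condition.* Under the strict inequalities of Laman, any element `i₀` may
be doubled without violating the weak ones. Hence for generic `η` the tensors `v i ⊗ η i` are
independent together with `v i₀ ⊗ e_{j₀}`, so some `φ` satisfies `φ (v i) ⊥ η i` for all `i`
and has `φ (v i₀)` nonzero in the coordinate `j₀`. Since `K` is infinite, one `φ` serves for all
`i₀` at once (`exists_linearMap_of_augmentedRows`). Such pairs `(φ, η)` are photos with generic
hyperplane markings, and specializing the hyperplane-marking matrix to one of them shows that it has
independent rows.
-/

noncomputable section

namespace MatroidRigidity

open MvPolynomial Module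

/-! ### Minors, specialization and independent transversals -/

theorem exists_submatrix_det_ne_zero {K ι m : Type*} [Field K] [Fintype ι] [DecidableEq ι]
    [Finite m] (X : Matrix ι m K) (h : LinearIndependent K X.row) :
    ∃ e : ι → m, (X.submatrix id e).det ≠ 0 := by
  have := Fintype.ofFinite m
  have hrk : X.rank = Fintype.card ι := LinearIndependent.rank_matrix h
  rw [Matrix.rank_eq_finrank_span_cols] at hrk
  obtain ⟨κ, a, hinj, hspan, hli⟩ := exists_linearIndependent' K X.col
  have : Fintype κ := Fintype.ofInjective a hinj
  have hcard : Fintype.card κ = Fintype.card ι := by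
    rw [← hrk, ← hspan]
    exact (finrank_span_eq_card hli).symm
  obtain ⟨g⟩ := Fintype.card_eq.mp hcard.symm
  refine ⟨a ∘ g, ?_⟩
  have h2 : LinearIndependent K (X.submatrix id (a ∘ g)).col := hli.comp g g.injective
  rw [Matrix.linearIndependent_cols_iff_isUnit, Matrix.isUnit_iff_isUnit_det] at h2
  exact h2.ne_zero

theorem linearIndependent_row_of_submatrix_det_ne_zero {K ι m : Type*} [Field K] [Fintype ι]
    [DecidableEq ι] {X : Matrix ι m K} {e : ι → m} (h : (X.submatrix id e).det ≠ 0) :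
    LinearIndependent K X.row := by
  have h2 : LinearIndependent K (X.submatrix id e).row := by
    rw [Matrix.linearIndependent_rows_iff_isUnit, Matrix.isUnit_iff_isUnit_det]
    exact h.isUnit
  exact LinearIndependent.of_comp (LinearMap.funLeft K K e) h2

/-- Linear independence can be checked after a specialization `θ`: a minor that is nonzero at the
special point is nonzero in `R`, hence in every field containing `R`. -/
theorem linearIndependent_of_specialization {R K Q ι m : Type*} [CommRing R] [Field K] [Field Q]
    [Finite ι] [Finite m] (θ : R →+* K) (j : R →+* Q) (hj : Function.Injective j)
    (X : Matrix ι m R) (h : LinearIndependent K (X.map θ).row) :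
    LinearIndependent Q (X.map j).row := by
  classical
  have := Fintype.ofFinite ι
  obtain ⟨e, he⟩ := exists_submatrix_det_ne_zero _ h
  refine linearIndependent_row_of_submatrix_det_ne_zero (e := e) ?_
  have h1 : θ (X.submatrix id e).det ≠ 0 := by
    rw [RingHom.map_det]; exact he
  have h2 : j (X.submatrix id e).det ≠ 0 := by
    rw [Ne, map_eq_zero_iff j hj]
    rintro h0
    exact h1 (by rw [h0, map_zero])
  rw [RingHom.map_det] at h2
  exact h2

/-- **Rado's theorem** for represented matroids. Following Welsh, the sets `X i` are shrunk to
singletons: if a set contained two elements neither of which could be removed, then two violating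
subfamilies would contradict the modularity of the dimension of subspaces. -/
theorem exists_transversal_linearIndependent {K V ι β : Type*} [Field K] [AddCommGroup V]
    [Module K V] [FiniteDimensional K V] [Finite ι] (u : ι → β → V) (X : ι → Finset β)
    (h : ∀ J : Finset ι, J.card ≤ finrank K ↥(⨆ i ∈ J, Submodule.span K (u i '' X i))) :
    ∃ c : ι → β, (∀ i, c i ∈ X i) ∧ LinearIndependent K (fun i => u i (c i)) := by
  classical
  have := Fintype.ofFinite ι
  induction hn : ∑ i, (X i).card using Nat.strong_induction_on generalizing X with
  | _ n ih =>
  subst hn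
  have hpos : ∀ i, 1 ≤ (X i).card := by
    intro i
    by_contra hcon
    have h0 : X i = ∅ := by
      rw [← Finset.card_eq_zero]; omega
    have := h {i}
    simp [h0] at this
  by_cases hone : ∀ i, (X i).card ≤ 1
  · -- all sets are singletons, and the count says that the chosen vectors span enough
    have hX : ∀ i, ∃ b, X i = {b} := fun i =>
      Finset.card_eq_one.mp (le_antisymm (hone i) (hpos i))
    choose c hc using hX
    refine ⟨c, fun i => by simp [hc], ?_⟩
    rw [linearIndependent_iff_card_le_finrank_span]
    have := h Finset.univ
    rw [Finset.card_univ] at this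
    refine this.trans (Submodule.finrank_mono ?_)
    refine iSup₂_le fun i _ => Submodule.span_mono ?_
    rintro _ ⟨b, hb, rfl⟩
    rw [hc] at hb
    simp only [Finset.coe_singleton, Set.mem_singleton_iff] at hb
    exact ⟨i, by rw [hb]⟩
  · push Not at hone
    obtain ⟨i, hi⟩ := hone
    obtain ⟨x, hx, y, hy, hxy⟩ := Finset.one_lt_card.mp hi
    -- shrinking the `i`-th set by one element strictly lowers the total size
    have step : ∀ z ∈ X i, (∀ J : Finset ι, J.card ≤ finrank K
        ↥(⨆ l ∈ J, Submodule.span K (u l '' (Function.update X i ((X i).erase z) l)))) →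
        ∃ c : ι → β, (∀ i, c i ∈ X i) ∧ LinearIndependent K (fun i => u i (c i)) := by
      intro z hz hJ
      have hle : ∀ l, Function.update X i ((X i).erase z) l ⊆ X l := by
        intro l
        by_cases hl : l = i
        · subst hl; simpa using Finset.erase_subset _ _
        · simp [Function.update_of_ne hl]
      obtain ⟨c, hc, hli⟩ := ih _ (Finset.sum_lt_sum (fun l _ => Finset.card_le_card (hle l))
        ⟨i, Finset.mem_univ _, by simpa using Finset.card_lt_card (Finset.erase_ssubset hz)⟩) _ hJ rfl
      exact ⟨c, fun l => hle l (hc l), hli⟩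
    by_cases h1 : ∀ J : Finset ι, J.card ≤ finrank K
        ↥(⨆ l ∈ J, Submodule.span K (u l '' (Function.update X i ((X i).erase x) l)))
    · exact step x hx h1
    by_cases h2 : ∀ J : Finset ι, J.card ≤ finrank K
        ↥(⨆ l ∈ J, Submodule.span K (u l '' (Function.update X i ((X i).erase y) l)))
    · exact step y hy h2
    exfalso
    -- a violating subfamily contains `i`; it is recorded as `J` with `i` removed
    have viol : ∀ z, (¬ ∀ J : Finset ι, J.card ≤ finrank K
        ↥(⨆ l ∈ J, Submodule.span K (u l '' (Function.update X i ((X i).erase z) l)))) →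
        ∃ J : Finset ι, i ∉ J ∧ finrank K ↥((⨆ l ∈ J, Submodule.span K (u l '' X l)) ⊔
          Submodule.span K (u i '' ((X i).erase z))) ≤ J.card := by
      intro z hz
      push Not at hz
      obtain ⟨J, hJ⟩ := hz
      have hcongr : ∀ J : Finset ι, i ∉ J →
          (⨆ l ∈ J, Submodule.span K (u l '' (Function.update X i ((X i).erase z) l))) =
          ⨆ l ∈ J, Submodule.span K (u l '' X l) := by
        intro J hiJ
        refine biSup_congr fun l hl => ?_
        rw [Function.update_of_ne (ne_of_mem_of_not_mem hl hiJ)]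
      have hiJ : i ∈ J := by
        by_contra hiJ
        rw [hcongr J hiJ] at hJ
        exact absurd (h J) (by omega)
      refine ⟨J.erase i, Finset.notMem_erase _ _, ?_⟩
      rw [← Finset.insert_erase hiJ, Finset.iSup_insert, hcongr _ (Finset.notMem_erase _ _),
        Function.update_self, Finset.card_insert_of_notMem (Finset.notMem_erase _ _),
        sup_comm] at hJ
      omega
    obtain ⟨J₁, hi₁, hJ₁⟩ := viol x h1
    obtain ⟨J₂, hi₂, hJ₂⟩ := viol y h2
    set Y₁ := (⨆ l ∈ J₁, Submodule.span K (u l '' X l)) ⊔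
          Submodule.span K (u i '' ((X i).erase x))
    set Y₂ := (⨆ l ∈ J₂, Submodule.span K (u l '' X l)) ⊔
          Submodule.span K (u i '' ((X i).erase y))
    -- `Y₁ ⊔ Y₂` contains the spans of the whole `X i`, because `x ≠ y`
    have hsub := Submodule.finrank_sup_add_finrank_inf_eq Y₁ Y₂
    have hsup : (⨆ l ∈ insert i (J₁ ∪ J₂), Submodule.span K (u l '' X l)) ≤ Y₁ ⊔ Y₂ := by
      rw [Finset.iSup_insert]
      refine sup_le (Submodule.span_le.mpr ?_) (iSup₂_le fun l hl => ?_)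
      · rintro _ ⟨b, hb, rfl⟩
        by_cases hbx : b = x
        · refine (le_sup_right.trans le_sup_right : _ ≤ Y₁ ⊔ Y₂)
            (Submodule.subset_span ⟨b, ?_, rfl⟩)
          simpa [hbx, hxy] using hx
        · refine (le_sup_right.trans le_sup_left : _ ≤ Y₁ ⊔ Y₂)
            (Submodule.subset_span ⟨b, ?_, rfl⟩)
          simpa [hbx] using hb
      · rcases Finset.mem_union.mp hl with hl | hl
        · exact (le_iSup₂_of_le (f := fun l (_ : l ∈ J₁) => Submodule.span K (u l '' X l)) l hl
            le_rfl).trans (le_sup_left.trans le_sup_left)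
        · exact (le_iSup₂_of_le (f := fun l (_ : l ∈ J₂) => Submodule.span K (u l '' X l)) l hl
            le_rfl).trans (le_sup_left.trans le_sup_right)
    have hinf : (⨆ l ∈ J₁ ∩ J₂, Submodule.span K (u l '' X l)) ≤ Y₁ ⊓ Y₂ := by
      refine iSup₂_le fun l hl => ?_
      rw [Finset.mem_inter] at hl
      exact le_inf
        ((le_iSup₂_of_le (f := fun l (_ : l ∈ J₁) => Submodule.span K (u l '' X l)) l hl.1
            le_rfl).trans le_sup_left)
        ((le_iSup₂_of_le (f := fun l (_ : l ∈ J₂) => Submodule.span K (u l '' X l)) l hl.2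
            le_rfl).trans le_sup_left)
    have e1 := (h _).trans (Submodule.finrank_mono hsup)
    have e2 := (h _).trans (Submodule.finrank_mono hinf)
    rw [Finset.card_insert_of_notMem (by simp [hi₁, hi₂])] at e1
    have e3 := Finset.card_union_add_card_inter J₁ J₂
    omega

/-! ### Tensors with the vectors of a family -/

/-- The coordinates of the elementary tensor `x ⊗ y` in the standard basis. -/
def tensorRow {R : Type*} [Mul R] {r d : ℕ} (x : Fin r → R) (y : Fin d → R) :
    Fin r × Fin d → R :=
  fun p => x p.1 * y p.2

/-- The Laman condition for a family of vectors: membership of the whole index set in the Laman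
complex, with ranks expressed as dimensions of spans. -/
def IsLaman {F ι : Type*} [Field F] {r : ℕ} (d : ℕ) (v : ι → Fin r → F) : Prop :=
  ∀ S : Finset ι, S.Nonempty → S.card < d * finrank F (Submodule.span F (v '' S))

theorem tensorRow_add_left {K : Type*} [Field K] {r d : ℕ} (x x' : Fin r → K) (y : Fin d → K) :
    tensorRow (x + x') y = tensorRow x y + tensorRow x' y := by
  ext p; simp [tensorRow, add_mul]

theorem tensorRow_smul_left {K : Type*} [Field K] {r d : ℕ} (a : K) (x : Fin r → K)
    (y : Fin d → K) : tensorRow (a • x) y = a • tensorRow x y := by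
  ext p; simp [tensorRow, mul_assoc]

theorem tensorRow_smul_right {K : Type*} [Field K] {r d : ℕ} (a : K) (x : Fin r → K)
    (y : Fin d → K) : tensorRow x (a • y) = a • tensorRow x y := by
  ext p; simp [tensorRow]; ring

theorem tensorRow_eq_sum {K : Type*} [Field K] {r d : ℕ} (x : Fin r → K) (y : Fin d → K) :
    tensorRow x y = ∑ j, y j • tensorRow x (Pi.single j 1) := by
  ext p; simp [tensorRow, Finset.sum_apply, Pi.single_apply]; ring

theorem extendScalars_add {F K : Type*} [Field F] [Field K] [Algebra F K] {r : ℕ}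
    (x y : Fin r → F) :
    extendScalars K (x + y) = extendScalars K x + extendScalars K y := by
  ext; simp [extendScalars]

theorem extendScalars_smul {F K : Type*} [Field F] [Field K] [Algebra F K] {r : ℕ}
    (a : F) (x : Fin r → F) :
    extendScalars K (a • x) = algebraMap F K a • extendScalars K x := by
  ext; simp [extendScalars]

theorem linearIndependent_tensorRow_single {K κ : Type*} [Field K] [Finite κ] {r : ℕ} (d : ℕ)
    {v : κ → Fin r → K} (h : LinearIndependent K v) :
    LinearIndependent K (fun q : κ × Fin d => tensorRow (v q.1) (Pi.single q.2 (1 : K))) := by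
  have := Fintype.ofFinite κ
  rw [Fintype.linearIndependent_iff] at h ⊢
  rintro g hg ⟨i, j⟩
  refine h (fun i => g (i, j)) ?_ i
  ext p
  simpa [Fintype.sum_prod_type, Finset.sum_apply, tensorRow, Pi.single_apply]
    using congrFun hg (p, j)

/-- A maximal independent subfamily of the vectors indexed by `S`. -/
theorem exists_basis_of_family.{u} {F : Type*} {ι : Type u} [Field F] {r : ℕ} (v : ι → Fin r → F)
    (S : Finset ι) : ∃ (κ : Type u) (_ : Fintype κ) (a : κ → ι), (∀ k, a k ∈ S) ∧
      LinearIndependent F (v ∘ a) ∧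
      Submodule.span F (Set.range (v ∘ a)) = Submodule.span F (v '' S) ∧
      Fintype.card κ = finrank F (Submodule.span F (v '' S)) := by
  obtain ⟨κ, a, hinj, hspan, hli⟩ := exists_linearIndependent' F (fun i : S => v i)
  have : Fintype κ := Fintype.ofInjective a hinj
  have hr : Set.range (fun i : S => v i) = v '' S := by
    ext x; simp
  rw [hr] at hspan
  refine ⟨κ, this, fun k => a k, fun k => (a k).2, hli, hspan, ?_⟩
  rw [← hspan]
  exact (finrank_span_eq_card hli).symm

/-- The case of Rado's theorem in which the `i`-th set consists of the tensors `v i ⊗ e_j`: a family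
satisfying the weak count is a union of `d` independent sets, the classes of `c`. -/
theorem exists_coloring {F ι : Type*} [Field F] [Finite ι] {r d : ℕ} (v : ι → Fin r → F)
    (h : ∀ S : Finset ι, S.card ≤ d * finrank F (Submodule.span F (v '' S))) :
    ∃ c : ι → Fin d, LinearIndependent F (fun i => tensorRow (v i) (Pi.single (c i) (1 : F))) := by
  set u : ι → Fin d → (Fin r × Fin d → F) := fun i j => tensorRow (v i) (Pi.single j 1) with hu
  have key : ∀ S : Finset ι, S.card ≤ finrank F
      ↥(⨆ i ∈ S, Submodule.span F (u i '' ((Finset.univ : Finset (Fin d)) : Set (Fin d)))) := by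
    intro S
    obtain ⟨κ, _, a, haS, hli, -, hcard⟩ := exists_basis_of_family v S
    have h2 := linearIndependent_tensorRow_single d hli
    calc S.card ≤ d * Fintype.card κ := hcard ▸ h S
      _ = Fintype.card (κ × Fin d) := by rw [Fintype.card_prod, Fintype.card_fin, mul_comm]
      _ = _ := (finrank_span_eq_card h2).symm
      _ ≤ _ := by
        refine Submodule.finrank_mono (Submodule.span_le.mpr ?_)
        rintro _ ⟨q, rfl⟩
        refine Submodule.mem_iSup_of_mem (a q.1) (Submodule.mem_iSup_of_mem (haS q.1) ?_)
        exact Submodule.subset_span ⟨q.2, by simp, rfl⟩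
  obtain ⟨c, -, hc⟩ := exists_transversal_linearIndependent u (fun _ => Finset.univ) key
  exact ⟨c, hc⟩

/-- The linear functional `x ⊗ y ↦ ⟨ψ x, y⟩` attached to a linear map `ψ`. -/
def pairing {K : Type*} [Field K] {r d : ℕ} (ψ : (Fin r → K) →ₗ[K] (Fin d → K)) :
    (Fin r × Fin d → K) →ₗ[K] K :=
  ∑ j, LinearMap.proj j ∘ₗ ψ ∘ₗ LinearMap.funLeft K K (fun p => (p, j))

theorem pairing_tensorRow {K : Type*} [Field K] {r d : ℕ} (ψ : (Fin r → K) →ₗ[K] (Fin d → K))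
    (x : Fin r → K) (y : Fin d → K) : pairing ψ (tensorRow x y) = ∑ j, ψ x j * y j := by
  simp only [pairing, LinearMap.sum_apply, LinearMap.comp_apply, LinearMap.proj_apply]
  refine Finset.sum_congr rfl fun j _ => ?_
  have : LinearMap.funLeft K K (fun p => (p, j)) (tensorRow x y) = y j • x := by
    ext p; simp [LinearMap.funLeft_apply, tensorRow, mul_comm]
  rw [this, map_smul, Pi.smul_apply, smul_eq_mul, mul_comm]

/-- The counting bound: independent tensors `v i ⊗ y i` lie in the span of all `v i ⊗ e_j`, and the
functional attached to `ψ` cuts out a proper subspace of it. -/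
theorem card_lt_of_linearIndependent_tensorRow {F K ι : Type*} [Field F] [Field K] [Algebra F K]
    {r d : ℕ} (v : ι → Fin r → F) (S : Finset ι) (y : ι → Fin d → K)
    (hli : LinearIndependent K (fun i : S => tensorRow (extendScalars K (v i)) (y i)))
    (ψ : (Fin r → K) →ₗ[K] (Fin d → K))
    (hψ : ∀ i ∈ S, ∑ j, ψ (extendScalars K (v i)) j * y i j = 0)
    (hne : ∃ i ∈ S, ψ (extendScalars K (v i)) ≠ 0) :
    S.card < d * finrank F (Submodule.span F (v '' S)) := by
  obtain ⟨κ, _, a, haS, -, hspan, hcard⟩ := exists_basis_of_family v S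
  set g : κ × Fin d → (Fin r × Fin d → K) :=
    fun q => tensorRow (extendScalars K (v (a q.1))) (Pi.single q.2 1) with hg
  set U := Submodule.span K (Set.range g) with hU
  have hmem : ∀ x ∈ Submodule.span F (Set.range (v ∘ a)), ∀ j,
      tensorRow (extendScalars K x) (Pi.single j (1 : K)) ∈ U := by
    intro x hx j
    induction hx using Submodule.span_induction with
    | mem x h =>
      obtain ⟨k, rfl⟩ := h
      exact Submodule.subset_span ⟨(k, j), rfl⟩
    | zero =>
      have : tensorRow (extendScalars K (0 : Fin r → F)) (Pi.single j (1 : K)) =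
          (0 : Fin r × Fin d → K) := by
        ext; simp [tensorRow, extendScalars]
      rw [this]; exact U.zero_mem
    | add x y _ _ hx hy =>
      rw [extendScalars_add, tensorRow_add_left]; exact U.add_mem hx hy
    | smul c x _ hx =>
      rw [extendScalars_smul, tensorRow_smul_left]; exact U.smul_mem _ hx
  have hv : ∀ i ∈ S, ∀ j, tensorRow (extendScalars K (v i)) (Pi.single j (1 : K)) ∈ U := by
    intro i hi
    refine hmem _ ?_
    rw [hspan]
    exact Submodule.subset_span ⟨i, hi, rfl⟩
  have hlt : U ⊓ LinearMap.ker (pairing ψ) < U := by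
    refine lt_of_le_of_ne inf_le_left fun heq => ?_
    obtain ⟨i, hi, hne⟩ := hne
    apply hne
    ext j
    have := (inf_eq_left.mp heq) (hv i hi j)
    rw [LinearMap.mem_ker, pairing_tensorRow] at this
    simpa [Pi.single_apply] using this
  have hle : Submodule.span K (Set.range fun i : S => tensorRow (extendScalars K (v i)) (y i)) ≤
      U ⊓ LinearMap.ker (pairing ψ) := by
    rw [Submodule.span_le]
    rintro _ ⟨i, rfl⟩
    refine ⟨?_, ?_⟩
    · simp only [SetLike.mem_coe]
      rw [tensorRow_eq_sum]
      exact U.sum_mem fun j _ => U.smul_mem _ (hv i i.2 j)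
    · simp only [SetLike.mem_coe, LinearMap.mem_ker, pairing_tensorRow]
      exact hψ i i.2
  calc S.card = Fintype.card S := by simp
    _ = _ := (finrank_span_eq_card hli).symm
    _ ≤ _ := Submodule.finrank_mono hle
    _ < finrank K U := Submodule.finrank_lt_finrank_of_lt hlt
    _ ≤ Fintype.card (κ × Fin d) := finrank_range_le_card g
    _ = _ := by rw [Fintype.card_prod, Fintype.card_fin, hcard, mul_comm]

theorem linearIndependent_tensorRow_extendScalars {F K ι : Type*} [Field F] [Field K]
    [Algebra F K] [Finite ι] {r d : ℕ} {v : ι → Fin r → F} {c : ι → Fin d}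
    (h : LinearIndependent F (fun i => tensorRow (v i) (Pi.single (c i) (1 : F)))) :
    LinearIndependent K
      (fun i => tensorRow (extendScalars K (v i)) (Pi.single (c i) (1 : K))) := by
  have h2 := linearIndependent_of_specialization (RingHom.id F) (algebraMap F K)
    (algebraMap F K).injective
    (Matrix.of fun i => tensorRow (v i) (Pi.single (c i) (1 : F))) (by exact h)
  convert h2 using 1
  ext i p
  simp only [Matrix.row, Matrix.map_apply, Matrix.of_apply, tensorRow, extendScalars, map_mul]
  congr 1
  simp [Pi.single_apply, apply_ite]

/-! ### The complexes in terms of linear independence -/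

theorem vectorMatroid_indep_iff {K ι V : Type*} [Field K] [AddCommGroup V] [Module K V] [Finite ι]
    (w : ι → V) (I : Set ι) : (vectorMatroid K w).Indep I ↔ LinearIndepOn K w I := by
  simp [vectorMatroid]

theorem vectorMatroid_eRk_toNat {K ι V : Type*} [Field K] [AddCommGroup V] [Module K V] [Finite ι]
    (w : ι → V) (A : Set ι) :
    ((vectorMatroid K w).eRk A).toNat = finrank K (Submodule.span K (w '' A)) := by
  obtain ⟨I, hI⟩ := (vectorMatroid K w).exists_isBasis A (Set.subset_univ _)
  have hli : LinearIndepOn K w I := (vectorMatroid_indep_iff w I).mp hI.indep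
  have hspan : Submodule.span K (w '' A) = Submodule.span K (w '' I) := by
    refine le_antisymm (Submodule.span_le.mpr ?_) (Submodule.span_mono (Set.image_mono hI.subset))
    rintro _ ⟨e, he, rfl⟩
    by_contra hne
    have heI : e ∉ I := fun h => hne (Submodule.subset_span ⟨e, h, rfl⟩)
    have := (vectorMatroid_indep_iff w _).mpr (hli.insert hne)
    exact heI (hI.mem_of_insert_indep he this)
  have hfin : Fintype I := Fintype.ofFinite I
  have h := finrank_span_eq_card (R := K) (b := fun i : I => w i) hli
  rw [hI.eRk_eq_encard, hspan, Set.image_eq_range, h, ← Nat.card_eq_fintype_card,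
    Nat.card_coe_set_eq]
  rfl

theorem mem_lamanComplex_iff {F ι : Type*} [Field F] [Finite ι] {r : ℕ} (v : ι → Fin r → F)
    (d : ℕ) (A : Set ι) :
    A ∈ lamanComplex (vectorMatroid F v) (d : ℝ) ↔ IsLaman d (fun i : A => v i) := by
  have himg : ∀ S : Set A, (fun i : A => v i) '' S = v '' (Subtype.val '' S) := by
    intro S; rw [Set.image_image]
  constructor
  · rintro ⟨-, h⟩ S hS
    have := h (Subtype.val '' (S : Set A)) (by rintro _ ⟨i, -, rfl⟩; exact i.2)
      (by simpa using hS)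
    rw [vectorMatroid_eRk_toNat, ← himg, Set.ncard_image_of_injective _ Subtype.val_injective,
      Set.ncard_coe_finset] at this
    exact_mod_cast this
  · intro h
    refine ⟨Set.subset_univ _, fun A' hA' hne => ?_⟩
    have hval : Subtype.val '' ((Subtype.val ⁻¹' A' : Set A)) = A' := by
      rw [Subtype.image_preimage_coe, Set.inter_eq_right.mpr hA']
    have hfin : (Subtype.val ⁻¹' A' : Set A).Finite := Set.toFinite _
    have := h hfin.toFinset (by
      obtain ⟨a, ha⟩ := hne
      exact ⟨⟨a, hA' ha⟩, by simpa using ha⟩)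
    rw [himg, hfin.coe_toFinset, hval, ← Set.ncard_eq_toFinset_card _ hfin,
      ← Set.ncard_image_of_injective _ Subtype.val_injective, hval] at this
    rw [vectorMatroid_eRk_toNat]
    exact_mod_cast this

theorem mem_rigidityComplex_iff {F ι : Type*} [Field F] [Finite ι] {r : ℕ} (v : ι → Fin r → F)
    (d : ℕ) (A : Set ι) : A ∈ rigidityComplex d v ↔
      LinearIndependent (PhotoField F r d) (rigidityMatrix d (fun i : A => v i)).row :=
  vectorMatroid_indep_iff _ _

theorem mem_hyperplaneComplex_iff {F ι : Type*} [Field F] [Finite ι] {r : ℕ}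
    (v : ι → Fin r → F) (d : ℕ) (A : Set ι) : A ∈ hyperplaneComplex d v ↔
      LinearIndependent (MarkedField F ι r d) (fun i : A => hyperplaneMatrix d v i) :=
  vectorMatroid_indep_iff _ _

/-- The linear form with coefficients `x` in the variables `f a`. -/
def linForm {F σ : Type*} [Field F] {r : ℕ} (f : Fin r → σ) (x : Fin r → F) : MvPolynomial σ F :=
  ∑ a, X (f a) * C (x a)

theorem linForm_ne_zero {F σ : Type*} [Field F] {r : ℕ} {f : Fin r → σ}
    (hf : Function.Injective f) {x : Fin r → F} (hx : x ≠ 0) : linForm f x ≠ 0 := by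
  classical
  obtain ⟨a, ha⟩ := Function.ne_iff.mp hx
  intro h
  apply ha
  have := congrArg (eval (fun s => if s = f a then 1 else 0)) h
  simpa [linForm, hf.eq_iff] using this

theorem algebraMap_linForm {F σ : Type*} [Field F] {r : ℕ} (f : Fin r → σ) (x : Fin r → F) :
    algebraMap (MvPolynomial σ F) (FractionRing (MvPolynomial σ F)) (linForm f x) =
      ∑ a, algebraMap (MvPolynomial σ F) (FractionRing (MvPolynomial σ F)) (X (f a)) *
        extendScalars (FractionRing (MvPolynomial σ F)) x a := by
  rw [linForm, map_sum]
  refine Finset.sum_congr rfl fun a _ => ?_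
  rw [map_mul, extendScalars,
    IsScalarTower.algebraMap_apply F (MvPolynomial σ F) (FractionRing (MvPolynomial σ F))]
  rfl

theorem eval₂Hom_linForm {F K σ : Type*} [Field F] [Field K] [Algebra F K] {r : ℕ} {d : ℕ}
    (φ : (Fin r → K) →ₗ[K] (Fin d → K)) (g : σ → K) (f : Fin r → σ) (j : Fin d)
    (hg : ∀ a, g (f a) = φ (Pi.single a 1) j) (x : Fin r → F) :
    eval₂Hom (algebraMap F K) g (linForm f x) = φ (extendScalars K x) j := by
  rw [LinearMap.pi_apply_eq_sum_univ φ, linForm, map_sum, Finset.sum_apply]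
  refine Finset.sum_congr rfl fun a _ => ?_
  rw [map_mul, eval₂Hom_X', eval₂Hom_C, hg, Pi.smul_apply, smul_eq_mul, mul_comm]
  congr 2
  exact congrFun (congrArg φ (by ext b; simp [Pi.single_apply, eq_comm])) j

theorem genericPhoto_mulVec {F : Type*} [Field F] {r : ℕ} (d : ℕ) (x : Fin r → F) (j : Fin d) :
    (genericPhoto F r d).mulVec (extendScalars (PhotoField F r d) x) j =
      algebraMap (MvPolynomial (Fin d × Fin r) F) _ (linForm (fun a => (j, a)) x) := by
  rw [algebraMap_linForm]; rfl

theorem markedImage_eq {F ι : Type*} [Field F] {r : ℕ} (d : ℕ) (v : ι → Fin r → F) (i : ι)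
    (j : Fin d) : markedImage d v i j =
      algebraMap (MvPolynomial ((Fin d × Fin r) ⊕ (ι × Fin (d - 1))) F) _
        (linForm (fun a => Sum.inl (j, a)) (v i)) := by
  rw [algebraMap_linForm]; rfl

theorem genericPhoto_mulVec_ne_zero {F : Type*} [Field F] {r : ℕ} {d : ℕ} {x : Fin r → F}
    (hx : x ≠ 0) (j : Fin d) :
    (genericPhoto F r d).mulVec (extendScalars (PhotoField F r d) x) j ≠ 0 := by
  rw [genericPhoto_mulVec, Ne, map_eq_zero_iff _ (IsFractionRing.injective _ _)]
  exact linForm_ne_zero (fun a b h => by simpa using h) hx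

theorem markedImage_ne_zero {F ι : Type*} [Field F] {r : ℕ} {d : ℕ} {v : ι → Fin r → F} {i : ι}
    (hx : v i ≠ 0) (j : Fin d) : markedImage d v i j ≠ 0 := by
  rw [markedImage_eq, Ne, map_eq_zero_iff _ (IsFractionRing.injective _ _)]
  exact linForm_ne_zero (fun a b h => by simpa using h) hx

theorem ne_zero_of_tensorRow_ne_zero {F K : Type*} [Field F] [Field K] [Algebra F K] {r d : ℕ}
    {x : Fin r → F} {y : Fin d → K} (h : tensorRow (extendScalars K x) y ≠ 0) : x ≠ 0 := by
  rintro rfl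
  apply h
  ext p; simp [tensorRow, extendScalars]

/-- The alternating form in the first two coordinates gives a linear functional on tensors which
kills every `x ⊗ φ(x)`. -/
theorem isLaman_of_rigidityMatrix {F ι : Type*} [Field F] {r d : ℕ} (hd : 1 < d)
    {v : ι → Fin r → F}
    (h : LinearIndependent (PhotoField F r d) (rigidityMatrix d v).row) : IsLaman d v := by
  intro S hS
  set φ := (genericPhoto F r d).mulVecLin with hφ
  let j₀ : Fin d := ⟨0, by omega⟩
  let j₁ : Fin d := ⟨1, hd⟩
  have h01 : j₀ ≠ j₁ := by simp [j₀, j₁]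
  let ψ : (Fin r → PhotoField F r d) →ₗ[PhotoField F r d] (Fin d → PhotoField F r d) :=
    LinearMap.pi fun j => if j = j₀ then LinearMap.proj j₁ ∘ₗ φ else
      if j = j₁ then -(LinearMap.proj j₀ ∘ₗ φ) else 0
  have hψ₀ : ∀ x, ψ x j₀ = φ x j₁ := fun x => by simp [ψ]
  have hψ₁ : ∀ x, ψ x j₁ = -φ x j₀ := fun x => by simp [ψ, h01.symm]
  have hψ₂ : ∀ x j, j ≠ j₀ → j ≠ j₁ → ψ x j = 0 := fun x j h0 h1 => by simp [ψ, h0, h1]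
  refine card_lt_of_linearIndependent_tensorRow v S
    (fun i => φ (extendScalars (PhotoField F r d) (v i)))
    (h.comp Subtype.val Subtype.val_injective) ψ ?_ ?_
  · intro i _
    rw [Finset.sum_eq_add j₀ j₁ h01 (fun j _ hj => by rw [hψ₂ _ _ hj.1 hj.2, zero_mul])
      (by simp) (by simp), hψ₀, hψ₁]
    ring
  · obtain ⟨i, hi⟩ := hS
    refine ⟨i, hi, fun h0 => ?_⟩
    have hv : v i ≠ 0 := ne_zero_of_tensorRow_ne_zero (h.ne_zero i)
    apply genericPhoto_mulVec_ne_zero hv j₁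
    have := congrFun h0 j₀
    rwa [hψ₀] at this

theorem sum_markedImage_mul_genericNormal {F ι : Type*} [Field F] {r d : ℕ} (hd : 0 < d)
    {v : ι → Fin r → F} {i : ι} (hv : v i ≠ 0) :
    ∑ j, markedImage d v i j * genericNormal d v i j = 0 := by
  obtain ⟨k, rfl⟩ : ∃ k, d = k + 1 := ⟨d - 1, by omega⟩
  rw [Fin.sum_univ_castSucc]
  have hlast := markedImage_ne_zero hv (Fin.last k)
  have h1 : genericNormal (k + 1) v i (Fin.last k) * markedImage (k + 1) v i (Fin.last k) =
      -∑ l : Fin k, genericNormal (k + 1) v i l.castSucc * markedImage (k + 1) v i l.castSucc := by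
    have : ∀ l : Fin k, genericNormal (k + 1) v i l.castSucc =
        algebraMap (MvPolynomial ((Fin (k + 1) × Fin r) ⊕ (ι × Fin (k + 1 - 1))) F) _
          (X (Sum.inr (i, l))) := by
      intro l
      simp [genericNormal]
    simp only [this]
    simp only [genericNormal, Fin.val_last, add_tsub_cancel_right, lt_self_iff_false,
      dite_false]
    rw [div_mul_cancel₀ _ hlast]
    rfl
  rw [mul_comm (markedImage (k + 1) v i (Fin.last k)), h1, add_neg_eq_zero]
  exact Finset.sum_congr rfl fun l _ => mul_comm _ _

/-- The counting bound applies to the generic matrix, which pairs each `v i` to zero with its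
generic normal. -/
theorem isLaman_of_hyperplaneMatrix {F ι : Type*} [Field F] {r d : ℕ} (hd : 0 < d)
    {v : ι → Fin r → F} {A : Set ι}
    (h : LinearIndependent (MarkedField F ι r d) (fun i : A => hyperplaneMatrix d v i)) :
    IsLaman d (fun i : A => v i) := by
  intro S hS
  have hv : ∀ i : A, v i ≠ 0 := fun i => ne_zero_of_tensorRow_ne_zero (h.ne_zero i)
  refine card_lt_of_linearIndependent_tensorRow (fun i : A => v i) S
    (fun i => genericNormal d v i) (h.comp Subtype.val Subtype.val_injective)
    (Matrix.mulVecLin (fun j a => algebraMap (MvPolynomial ((Fin d × Fin r) ⊕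
      (ι × Fin (d - 1))) F) (MarkedField F ι r d) (X (Sum.inl (j, a))))) ?_ ?_
  · intro i _
    exact sum_markedImage_mul_genericNormal hd (hv i)
  · obtain ⟨i, hi⟩ := hS
    refine ⟨i, hi, fun h0 => markedImage_ne_zero (hv i) ⟨0, hd⟩ (congrFun h0 ⟨0, hd⟩)⟩

/-! ### Hyperplanes, Plücker coordinates and slopes -/

/-- The maximal minor of a `k × d` matrix in the columns `S`. -/
def minors {R : Type*} [CommRing R] {k d : ℕ} (B : Fin k → Fin d → R) (S : Fin k ↪o Fin d) : R :=
  Matrix.det (Matrix.of fun a c : Fin k => B a (S c))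

/-- The vector of signed Plücker coordinates in the columns selected by `T`: it is supported on
those columns and orthogonal to the `k`-plane. -/
def normalVec {R : Type*} [CommRing R] {k d : ℕ} (T : Fin (k + 1) ↪o Fin d)
    (x : (Fin k ↪o Fin d) → R) (j : Fin d) : R :=
  ∑ t, if T t = j then (-1) ^ (t : ℕ) * x ((Fin.succAboveOrderEmb t).trans T) else 0

/-- Expansion, along the first row, of a determinant with a repeated row. -/
theorem sum_mul_normalVec {R : Type*} [CommRing R] {k d : ℕ} (T : Fin (k + 1) ↪o Fin d)
    (B : Fin k → Fin d → R) (a : Fin k) : ∑ j, B a j * normalVec T (minors B) j = 0 := by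
  let M : Matrix (Fin (k + 1)) (Fin (k + 1)) R :=
    Matrix.of (Fin.cons (fun t => B a (T t)) (fun a' t => B a' (T t)) : Fin (k + 1) → _)
  have hM : M.det = 0 := Matrix.det_zero_of_row_eq (i := 0) (j := a.succ)
    (Fin.succ_ne_zero a).symm (by ext t; simp [M])
  rw [Matrix.det_succ_row_zero] at hM
  rw [← hM]
  simp only [normalVec, Finset.mul_sum]
  rw [Finset.sum_comm]
  refine Finset.sum_congr rfl fun t _ => ?_
  rw [Finset.sum_eq_single (T t)]
  · simp only [if_true]
    have : M.submatrix Fin.succ t.succAbove =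
        Matrix.of fun a c => B a (((Fin.succAboveOrderEmb t).trans T) c) := by
      ext a c; simp [M]
    rw [this, minors]
    simp [M]
    ring
  · intro j _ hj
    rw [if_neg hj.symm, mul_zero]
  · simp

theorem exists_normalVec_eq_single {R : Type*} [CommRing R] {k d : ℕ} (hk : 0 < k)
    (T : Fin (k + 1) ↪o Fin d) (t₀ : Fin (k + 1)) :
    ∃ B : Fin k → Fin d → R, normalVec T (minors B) = Pi.single (T t₀) 1 := by
  -- the first row is rescaled to absorb the sign of the cofactor at `t₀`
  let s : Fin k → R := fun a => if a = ⟨0, hk⟩ then (-1) ^ (t₀ : ℕ) else 1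
  let B : Fin k → Fin d → R := fun a => s a • Pi.single (T (t₀.succAbove a)) 1
  have hs : ∏ a, s a = (-1) ^ (t₀ : ℕ) := by simp [s]
  have hm : ∀ t, minors B ((Fin.succAboveOrderEmb t).trans T) =
      if t = t₀ then (-1) ^ (t₀ : ℕ) else 0 := by
    intro t
    have h1 : minors B ((Fin.succAboveOrderEmb t).trans T) = (∏ a, s a) *
        Matrix.det (Matrix.of fun a c : Fin k =>
          if t.succAbove c = t₀.succAbove a then (1 : R) else 0) := by
      rw [← Matrix.det_mul_column, minors]
      congr 1
      ext a c
      simp [B, Pi.single_apply]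
    rw [h1, hs]
    split_ifs with ht
    · subst ht
      have : (Matrix.of fun a c : Fin k =>
          if t.succAbove c = t.succAbove a then (1 : R) else 0) = 1 := by
        ext a c
        simp [Matrix.one_apply, eq_comm]
      rw [this, Matrix.det_one, mul_one]
    · obtain ⟨a, ha⟩ := Fin.exists_succAbove_eq ht
      rw [Matrix.det_eq_zero_of_row_eq_zero a, mul_zero]
      intro c
      simp [ha, Fin.succAbove_ne]
  refine ⟨B, ?_⟩
  ext j
  simp only [normalVec, hm, Pi.single_apply]
  rw [Finset.sum_eq_single t₀]
  · simp only [if_true, eq_comm (a := j), ← mul_pow]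
    simp
  · intro t _ ht
    simp [ht]
  · simp

/-- Every coordinate belongs to a set of `k + 1` columns, so that every coordinate vector occurs as
the vector of signed minors of some matrix. -/
theorem exists_orderEmb_apply_eq {k d : ℕ} (hk : k < d) (c : Fin d) :
    ∃ (T : Fin (k + 1) ↪o Fin d) (t : Fin (k + 1)), T t = c := by
  obtain ⟨s, hcs, -, hs⟩ := Finset.exists_subsuperset_card_eq (n := k + 1)
    (Finset.subset_univ ({c} : Finset (Fin d))) (by simp) (by simpa using hk)
  refine ⟨s.orderEmbOfFin hs, ?_⟩
  have : c ∈ Set.range (s.orderEmbOfFin hs) := by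
    rw [Finset.range_orderEmbOfFin]
    simpa using hcs
  exact this

theorem linearIndependent_of_normalVec_ne_zero {K : Type*} [Field K] {k d : ℕ}
    {T : Fin (k + 1) ↪o Fin d} {B : Fin k → Fin d → K} (h : normalVec T (minors B) ≠ 0) :
    LinearIndependent K B := by
  have : ∃ S, minors B S ≠ 0 := by
    by_contra! hcon
    apply h
    ext j
    simp [normalVec, hcon]
  obtain ⟨S, hS⟩ := this
  exact linearIndependent_row_of_submatrix_det_ne_zero (X := Matrix.of B) (e := S) hS

theorem normalVec_map {R R' : Type*} [CommRing R] [CommRing R'] (f : R →+* R') {k d : ℕ}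
    (T : Fin (k + 1) ↪o Fin d) (x : (Fin k ↪o Fin d) → R) (j : Fin d) :
    f (normalVec T x j) = normalVec T (fun S => f (x S)) j := by
  simp [normalVec, apply_ite f]

/-- The point of the Grassmannian spanned by independent rows. -/
def rowSpan {K : Type*} [Field K] {k d : ℕ} (B : Fin k → Fin d → K) (h : LinearIndependent K B) :
    Gr K k d :=
  ⟨Submodule.span K (Set.range B), by simpa using finrank_span_eq_card h⟩

theorem plucker_basisSpan {K : Type*} [Field K] {k d : ℕ} (B : Fin k → Fin d → K)
    (h : LinearIndependent K B) (S : Fin k ↪o Fin d) :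
    plucker (W := (rowSpan B h).1) (Basis.span h) S = minors B S := by
  unfold plucker minors
  congr 1
  ext a c
  exact congrFun (congrArg Subtype.val (Basis.span_apply h a)) (S c)

theorem isMultihomogeneous_det {ι P K κ : Type*} [Field K] [Fintype κ] [DecidableEq κ] (a : κ → ι)
    (M : Matrix κ κ (MvPolynomial (ι × P) K))
    (h : ∀ i j, IsWeightedHomogeneous (fun p : ι × P => Finsupp.single p.1 1) (M i j)
      (Finsupp.single (a i) 1)) :
    IsMultihomogeneous M.det (∑ i, Finsupp.single (a i) 1) := by
  rw [IsMultihomogeneous, Matrix.det_apply]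
  refine IsWeightedHomogeneous.sum _ _ _ fun σ _ => ?_
  have h1 : IsWeightedHomogeneous (fun p : ι × P => Finsupp.single p.1 1)
      (∏ i, M (σ i) i) (∑ i, Finsupp.single (a i) 1) := by
    rw [← Equiv.sum_comp σ]
    exact IsWeightedHomogeneous.prod _ _ _ fun i _ => h _ _
  rw [← mem_weightedHomogeneousSubmodule] at h1 ⊢
  rw [Units.smul_def]
  exact zsmul_mem h1 _

/-- If the slopes can be prescribed generically, then a photo exists at which the vectors
`v i ⊗ N i` are independent, for linear forms `N i` in the Plücker coordinates of the `i`-th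
marking such that independence holds at some point. -/
theorem SlopeIndependent.exists_photo {F K ι : Type*} [Field F] [Field K] [Algebra F K]
    {r k d : ℕ} {v : ι → Fin r → F} (h : SlopeIndependent K k d v) (S : Finset ι)
    (N : ι → Fin d → MvPolynomial (ι × (Fin k ↪o Fin d)) K)
    (hN : ∀ i j, IsWeightedHomogeneous
      (fun p : ι × (Fin k ↪o Fin d) => Finsupp.single p.1 1) (N i j) (Finsupp.single i 1))
    (B : ι → Fin k → Fin d → K) (hB : ∀ i, LinearIndependent K (B i))
    (hli : LinearIndependent K (fun i : S => tensorRow (extendScalars K (v i))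
      (fun j => eval (fun p => minors (B p.1) p.2) (N i j)))) :
    ∃ (φ : (Fin r → K) →ₗ[K] (Fin d → K)) (W : GrProd ι K k d)
      (b : ∀ i, Basis (Fin k) K (W i).1),
      (∀ i, φ (extendScalars K (v i)) ∈ (W i).1 ∧ φ (extendScalars K (v i)) ≠ 0) ∧
      LinearIndependent K (fun i : S => tensorRow (extendScalars K (v i))
        (fun j => eval (fun p => plucker (b p.1) p.2) (N i j))) := by
  classical
  obtain ⟨e, he⟩ := exists_submatrix_det_ne_zero (Matrix.of _) hli
  let M : Matrix S S (MvPolynomial (ι × (Fin k ↪o Fin d)) K) :=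
    Matrix.of fun i i' => C (extendScalars K (v i) (e i').1) * N i (e i').2
  have hM : ∀ x, eval x M.det = ((Matrix.of fun i : S => tensorRow (extendScalars K (v i))
      (fun j => eval x (N i j))).submatrix id e).det := by
    intro x
    rw [RingHom.map_det]
    congr 1
    ext i i'
    simp [M, tensorRow]
  have hhom : IsMultihomogeneous M.det (∑ i : S, Finsupp.single (i : ι) 1) := by
    refine isMultihomogeneous_det Subtype.val M fun i i' => ?_
    rw [← zero_add (Finsupp.single (i : ι) 1)]
    exact (isWeightedHomogeneous_C _ _).mul (hN _ _)
  have hopen : IsOpen (nonvanishingLocus M.det : Set (GrProd ι K k d)) :=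
    TopologicalSpace.isOpen_generateFrom_of_mem ⟨_, _, hhom, rfl⟩
  have hne : (nonvanishingLocus M.det : Set (GrProd ι K k d)).Nonempty := by
    refine ⟨fun i => rowSpan (B i) (hB i), fun i => Basis.span (hB i), ?_⟩
    rw [hM]
    simp only [plucker_basisSpan]
    exact he
  obtain ⟨_, ⟨b, hb⟩, ⟨⟨φ, W⟩, ⟨hW, hφ⟩, rfl⟩⟩ := h.inter_open_nonempty _ hopen hne
  refine ⟨φ, W, b, fun i => ⟨hW i, hφ i⟩, ?_⟩
  rw [hM] at hb
  exact linearIndependent_row_of_submatrix_det_ne_zero hb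

/-- Slope independence provides at least one photo, and a photo in the cellule annihilates no
vector. -/
theorem SlopeIndependent.ne_zero {F K ι : Type*} [Field F] [Field K] [Algebra F K]
    {r k d : ℕ} (hk : 0 < k) (hkd : k < d) {v : ι → Fin r → F} (h : SlopeIndependent K k d v)
    (i : ι) : v i ≠ 0 := by
  obtain ⟨T, t, -⟩ := exists_orderEmb_apply_eq hkd ⟨0, by omega⟩
  obtain ⟨B, hB⟩ := exists_normalVec_eq_single (R := K) hk T t
  have hBli : LinearIndependent K B := linearIndependent_of_normalVec_ne_zero (T := T) (by
    rw [hB]; simp)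
  obtain ⟨φ, W, b, hφ, -⟩ := h.exists_photo ∅ (fun _ _ => 0)
    (fun _ _ => isWeightedHomogeneous_zero _ _ _) (fun _ => B) (fun _ => hBli)
    (linearIndependent_empty_type)
  intro h0
  apply (hφ i).2
  have : extendScalars K (v i) = 0 := by ext; simp [h0, extendScalars]
  rw [this, map_zero]

theorem isWeightedHomogeneous_normalVec {K ι : Type*} [Field K] {k d : ℕ}
    (T : Fin (k + 1) ↪o Fin d) (i : ι) (j : Fin d) :
    IsWeightedHomogeneous (fun p : ι × (Fin k ↪o Fin d) => Finsupp.single p.1 1)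
      (normalVec T (fun s => (X (i, s) : MvPolynomial (ι × (Fin k ↪o Fin d)) K)) j)
      (Finsupp.single i 1) := by
  refine IsWeightedHomogeneous.sum _ _ _ fun s _ => ?_
  split_ifs
  · rw [← mem_weightedHomogeneousSubmodule]
    rcases neg_one_pow_eq_or (MvPolynomial (ι × (Fin k ↪o Fin d)) K) (s : ℕ) with hs | hs
    · rw [hs, one_mul]
      exact isWeightedHomogeneous_X _ _ _
    · rw [hs, neg_one_mul]
      exact neg_mem (isWeightedHomogeneous_X _ _ _)
  · exact isWeightedHomogeneous_zero _ _ _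

theorem sum_mul_normalVec_plucker {K : Type*} [Field K] {k d : ℕ} (T : Fin (k + 1) ↪o Fin d)
    {W : Submodule K (Fin d → K)} (b : Basis (Fin k) K W) {w : Fin d → K} (hw : w ∈ W) :
    ∑ j, w j * normalVec T (plucker b) j = 0 := by
  have h1 : w = ∑ a, b.repr ⟨w, hw⟩ a • (b a : Fin d → K) := by
    have := congrArg W.subtype (b.sum_repr ⟨w, hw⟩)
    rw [map_sum] at this
    exact this.symm
  rw [h1]
  simp only [Finset.sum_apply, Pi.smul_apply, smul_eq_mul, Finset.sum_mul]
  rw [Finset.sum_comm]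
  refine Finset.sum_eq_zero fun a _ => ?_
  simp only [mul_assoc, ← Finset.mul_sum]
  convert mul_zero _
  exact sum_mul_normalVec T (fun a => (b a : Fin d → K)) a

/-- Slope independence implies the Laman condition for every dimension `0 < k < d` of the markings,
by applying the counting bound to a photo and to suitable normals of its markings. -/
theorem SlopeIndependent.isLaman {F K ι : Type*} [Field F] [Field K] [Algebra F K]
    {r k d : ℕ} (hk : 0 < k) (hkd : k < d) {v : ι → Fin r → F} (h : SlopeIndependent K k d v) :
    IsLaman d v := by
  classical
  intro S
  induction S using Finset.strongInduction with
  | _ S ih =>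
  intro hS
  have hd : 0 < d := by omega
  have hmono : ∀ {T T' : Finset ι}, T ⊆ T' → finrank F (Submodule.span F (v '' T)) ≤
      finrank F (Submodule.span F (v '' T')) := fun hT =>
    Submodule.finrank_mono (Submodule.span_mono (Set.image_mono (by exact_mod_cast hT)))
  -- the Laman condition on proper subsets gives the weak inequality on `S` itself
  have hle : ∀ T ⊆ S, T.card ≤ d * finrank F (Submodule.span F (v '' T)) := by
    intro T hT
    rcases T.eq_empty_or_nonempty with rfl | hTne
    · simp
    rcases hT.eq_or_ssubset with rfl | hlt
    · obtain ⟨a, ha⟩ := hS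
      rcases (T.erase a).eq_empty_or_nonempty with h0 | hne
      · have hT1 : T.card = 1 := by
          rw [← Finset.card_erase_add_one ha, h0]; simp
        rw [hT1]
        refine Nat.mul_pos hd (Nat.pos_of_ne_zero fun hz => h.ne_zero hk hkd a ?_)
        rw [Submodule.finrank_eq_zero, Submodule.span_eq_bot] at hz
        exact hz _ ⟨a, ha, rfl⟩
      · have h1 := ih _ (Finset.erase_ssubset ha) hne
        have h2 := Nat.mul_le_mul_left d (hmono (Finset.erase_subset a T))
        have h3 := Finset.card_erase_add_one ha
        omega
    · exact (ih T hlt hTne).le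
  obtain ⟨c, hc⟩ := exists_coloring (fun i : S => v i) (d := d) (by
    intro T
    have := hle (T.map (Function.Embedding.subtype _)) (by
      intro x hx
      simp only [Finset.mem_map] at hx
      obtain ⟨y, -, rfl⟩ := hx
      exact y.2)
    rw [Finset.card_map, Finset.coe_map, Set.image_image] at this
    exact this)
  let c' : ι → Fin d := fun i => if hi : i ∈ S then c ⟨i, hi⟩ else ⟨0, hd⟩
  choose T t hT using fun i => exists_orderEmb_apply_eq hkd (c' i)
  choose B hB using fun i => exists_normalVec_eq_single (R := K) hk (T i) (t i)
  let N : ι → Fin d → MvPolynomial (ι × (Fin k ↪o Fin d)) K := fun i =>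
    normalVec (T i) (fun s => X (i, s))
  have hNeval : ∀ x i j, eval x (N i j) = normalVec (T i) (fun s => x (i, s)) j := by
    intro x i j
    simp only [N, normalVec_map, eval_X]
  have hNhom : ∀ i j, IsWeightedHomogeneous
      (fun p : ι × (Fin k ↪o Fin d) => Finsupp.single p.1 1) (N i j) (Finsupp.single i 1) :=
    fun i j => isWeightedHomogeneous_normalVec (T i) i j
  have hBli : ∀ i, LinearIndependent K (B i) := fun i =>
    linearIndependent_of_normalVec_ne_zero (T := T i) (by rw [hB]; simp)
  have hNB : LinearIndependent K (fun i : S => tensorRow (extendScalars K (v i))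
      (fun j => eval (fun p => minors (B p.1) p.2) (N i j))) := by
    have heq : ∀ i : S, (fun j => eval (fun p => minors (B p.1) p.2) (N i j)) =
        Pi.single (c i) 1 := by
      intro i
      have : c' i = c i := by simp [c']
      rw [← this, ← hT i, ← hB i]
      ext j
      exact hNeval _ _ _
    simp only [heq]
    exact linearIndependent_tensorRow_extendScalars hc
  obtain ⟨φ, W, b, hφ, hli⟩ := h.exists_photo S N hNhom B hBli hNB
  simp only [hNeval] at hli
  refine card_lt_of_linearIndependent_tensorRow v S
    (fun i => normalVec (T i) (plucker (b i))) hli φ ?_ ?_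
  · intro i _
    exact sum_mul_normalVec_plucker (T i) (b i) (hφ i).1
  · obtain ⟨i, hi⟩ := hS
    exact ⟨i, hi, (hφ i).2⟩

/-- The inclusion of the first slope complex in the rigidity complex: at a photo with generic
image directions the rigidity matrix is proportional, row by row, to a generic matrix. -/
theorem SlopeIndependent.linearIndependent_rigidityMatrix {F K ι : Type*} [Field F] [Field K] [Algebra F K]
    [Finite ι] {r d : ℕ} (hd : 1 < d) {v : ι → Fin r → F} (h : SlopeIndependent K 1 d v) :
    LinearIndependent (PhotoField F r d) (rigidityMatrix d v).row := by
  have := Fintype.ofFinite ι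
  have hL := h.isLaman one_pos hd
  obtain ⟨c, hc⟩ := exists_coloring v (d := d) (by
    intro T
    rcases T.eq_empty_or_nonempty with rfl | hT
    · simp
    · exact (hL T hT).le)
  have hc' := linearIndependent_tensorRow_extendScalars (K := K) hc
  -- the Plücker coordinates of a line are the coordinates of a spanning vector
  let E : Fin d → (Fin 1 ↪o Fin d) := fun j =>
    OrderEmbedding.ofStrictMono (fun _ => j) (Subsingleton.strictMono _)
  obtain ⟨φ, W, b, hφ, hli⟩ := h.exists_photo Finset.univ (fun i j => X (i, E j))
    (fun i j => isWeightedHomogeneous_X _ _ _) (fun i _ => Pi.single (c i) 1)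
    (fun i => LinearIndependent.of_subsingleton 0 (by simp)) (by
      convert hc'.comp _ Subtype.val_injective using 2 with i
      simp only [Function.comp]
      congr 1
      ext j
      simp [minors, E])
  have hw : ∀ i, ∃ a : Kˣ, φ (extendScalars K (v i)) = a • (b i 0 : Fin d → K) := by
    intro i
    have h1 := congrArg Subtype.val ((b i).sum_repr ⟨_, (hφ i).1⟩)
    simp only [Fin.sum_univ_one, Submodule.coe_smul] at h1
    have h2 : (b i).repr ⟨_, (hφ i).1⟩ 0 ≠ 0 := by
      intro h0
      rw [h0, zero_smul] at h1
      exact (hφ i).2 h1.symm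
    exact ⟨Units.mk0 _ h2, h1.symm⟩
  choose a ha using hw
  have hli2 : LinearIndependent K (fun i => tensorRow (extendScalars K (v i))
      (φ (extendScalars K (v i)))) := by
    have h1 := (hli.comp (fun i : ι => ⟨i, Finset.mem_univ i⟩) (fun i j hij => by
      simpa using hij)).units_smul a
    convert h1 using 2 with i
    simp only [Pi.smul_apply', Function.comp_apply]
    rw [ha, Units.smul_def, Units.smul_def, tensorRow_smul_right]
    congr 2
    ext j
    simp [plucker, E]
  let Z : Matrix ι (Fin r × Fin d) (MvPolynomial (Fin d × Fin r) F) := Matrix.of fun i p =>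
    C (v i p.1) * linForm (fun a => (p.2, a)) (v i)
  have hZ := linearIndependent_of_specialization
    (eval₂Hom (algebraMap F K) (fun q : Fin d × Fin r => φ (Pi.single q.2 1) q.1))
    (algebraMap _ (PhotoField F r d)) (IsFractionRing.injective _ _) Z (by
      convert hli2 using 1
      ext i p
      simp only [Z, Matrix.row, Matrix.map_apply, Matrix.of_apply, tensorRow]
      rw [map_mul, eval₂Hom_C, eval₂Hom_linForm φ _ _ p.2 (fun _ => rfl)]
      rfl)
  have heq : rigidityMatrix d v = Z.map (algebraMap _ (PhotoField F r d)) := by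
    ext i p
    simp only [Z, Matrix.map_apply, Matrix.of_apply, rigidityMatrix,
      genericPhoto_mulVec, extendScalars, map_mul]
    rw [IsScalarTower.algebraMap_apply F (MvPolynomial (Fin d × Fin r) F) (PhotoField F r d)]
    rfl
  rw [heq]
  exact hZ

/-! ### Generic markings of Laman families -/

theorem exists_eval_ne_zero {K σ : Type*} [Field K] [Infinite K] {P : MvPolynomial σ K}
    (hP : P ≠ 0) : ∃ x, eval x P ≠ 0 := by
  by_contra! h
  exact hP (MvPolynomial.funext fun x => by rw [h x, map_zero])

/-- The rows `x i ⊗ η i`, together with the additional row `x i₀ ⊗ e_{j₀}`. -/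
def augmentedRows {R ι : Type*} [CommRing R] {r d : ℕ} (x : ι → Fin r → R) (i₀ : ι) (j₀ : Fin d)
    (η : ι → Fin d → R) : Option ι → Fin r × Fin d → R
  | none => tensorRow (x i₀) (Pi.single j₀ 1)
  | some i => tensorRow (x i) (η i)

/-- Doubling `i₀` raises cardinalities by at most one, so the weak count survives and the doubled
family can be colored. -/
theorem IsLaman.exists_augmented_coloring {F ι : Type*} [Field F] [Finite ι] {r d : ℕ}
    {v : ι → Fin r → F} (h : IsLaman d v) (i₀ : ι) (j₀ : Fin d) :
    ∃ c : ι → Fin d,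
      LinearIndependent F (augmentedRows v i₀ j₀ (fun i => Pi.single (c i) 1)) := by
  classical
  let v' : Option ι → Fin r → F := fun o => v (o.getD i₀)
  obtain ⟨c, hc⟩ := exists_coloring v' (d := d) (by
    intro S
    have hcard : S.card ≤ S.eraseNone.card + 1 := by
      rw [Finset.card_eraseNone_eq_card_erase]
      have := Finset.pred_card_le_card_erase (s := S) (a := none)
      omega
    rcases S.eraseNone.eq_empty_or_nonempty with h0 | hne
    · rcases S.eq_empty_or_nonempty with rfl | ⟨o, ho⟩
      · simp
      · have ho' : o = none := by
          cases o with
          | none => rfl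
          | some i =>
            have : i ∈ S.eraseNone := Finset.mem_eraseNone.mpr ho
            simp [h0] at this
        subst ho'
        rw [h0, Finset.card_empty] at hcard
        have h1 := h {i₀} (Finset.singleton_nonempty _)
        have h2 : finrank F (Submodule.span F (v '' ({i₀} : Finset ι))) ≤
            finrank F (Submodule.span F (v' '' S)) :=
          Submodule.finrank_mono (Submodule.span_mono (by
            rintro _ ⟨i, hi, rfl⟩
            simp only [Finset.coe_singleton, Set.mem_singleton_iff] at hi
            exact ⟨none, ho, by simp [v', hi]⟩))
        have h3 := Nat.mul_le_mul_left d h2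
        simp only [Finset.card_singleton] at h1
        omega
    · have h1 := h _ hne
      have h2 : finrank F (Submodule.span F (v '' S.eraseNone)) ≤
          finrank F (Submodule.span F (v' '' S)) :=
        Submodule.finrank_mono (Submodule.span_mono (by
          rintro _ ⟨i, hi, rfl⟩
          exact ⟨some i, Finset.mem_eraseNone.mp hi, rfl⟩))
      have h3 := Nat.mul_le_mul_left d h2
      omega)
  -- permuting the colours, the extra copy of `i₀` may be given the colour `j₀`
  let σ := Equiv.swap (c none) j₀
  refine ⟨fun i => σ (c (some i)), ?_⟩
  let f : (Fin r × Fin d → F) ≃ₗ[F] (Fin r × Fin d → F) :=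
    LinearEquiv.funCongrLeft F F ((Equiv.refl (Fin r)).prodCongr σ)
  have hf : ∀ (x : Fin r → F) j, f (tensorRow x (Pi.single j 1)) =
      tensorRow x (Pi.single (σ j) 1) := by
    intro x j
    ext p
    have hσ : σ p.2 = j ↔ p.2 = σ j := by
      rw [← Equiv.eq_symm_apply, Equiv.symm_swap]
    simp [f, LinearMap.funLeft_apply, tensorRow, Pi.single_apply, hσ]
  have := hc.map' f.toLinearMap (LinearEquiv.ker f)
  have heq : augmentedRows v i₀ j₀ (fun i => Pi.single (σ (c (some i))) 1) =
      f.toLinearMap ∘ fun o => tensorRow (v' o) (Pi.single (c o) 1) := by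
    ext1 o
    cases o with
    | none => simp [augmentedRows, hf, v', σ]
    | some i => simp [augmentedRows, hf, v']
  rw [heq]
  exact this

/-- Independence of the augmented rows is a generic condition on `η`. The polynomial `P` is a minor,
and the coloring provides a point, made of coordinate vectors, at which it does not vanish. -/
theorem IsLaman.exists_polynomial {F : Type*} (K : Type*) {ι : Type*} [Field F] [Field K]
    [Algebra F K] [Finite ι] {r d : ℕ} {v : ι → Fin r → F} (h : IsLaman d v) (i₀ : ι)
    (j₀ : Fin d) :
    ∃ (c : ι → Fin d) (P : MvPolynomial (ι × Fin d) K),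
      eval (fun q => (Pi.single (c q.1) 1 : Fin d → K) q.2) P ≠ 0 ∧
      ∀ η : ι → Fin d → K, eval (fun q => η q.1 q.2) P ≠ 0 →
        LinearIndependent K (augmentedRows (fun i => extendScalars K (v i)) i₀ j₀ η) := by
  classical
  have := Fintype.ofFinite ι
  obtain ⟨c, hc⟩ := h.exists_augmented_coloring i₀ j₀
  have hcK := linearIndependent_of_specialization (RingHom.id F) (algebraMap F K)
    (algebraMap F K).injective (Matrix.of (augmentedRows v i₀ j₀ (fun i => Pi.single (c i) 1)))
    (by exact hc)
  obtain ⟨e, he⟩ := exists_submatrix_det_ne_zero _ hcK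
  let M : Matrix (Option ι) (Fin r × Fin d) (MvPolynomial (ι × Fin d) K) :=
    Matrix.of (augmentedRows (fun i a => C (extendScalars K (v i) a)) i₀ j₀ (fun i j => X (i, j)))
  have hM : ∀ η : ι → Fin d → K, eval (fun q => η q.1 q.2) (M.submatrix id e).det =
      ((Matrix.of (augmentedRows (fun i => extendScalars K (v i)) i₀ j₀ η)).submatrix id e).det := by
    intro η
    rw [RingHom.map_det]
    congr 1
    ext o o'
    cases o with
    | none => simp [M, augmentedRows, tensorRow, Pi.single_apply, apply_ite (eval _)]
    | some i => simp [M, augmentedRows, tensorRow]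
  refine ⟨c, (M.submatrix id e).det, ?_, fun η hη => ?_⟩
  · rw [hM (fun i => Pi.single (c i) 1)]
    convert he using 3
    ext o p
    cases o with
    | none =>
      simp [augmentedRows, tensorRow, extendScalars, Pi.single_apply, apply_ite (algebraMap F K)]
    | some i =>
      simp [augmentedRows, tensorRow, extendScalars, Pi.single_apply, apply_ite (algebraMap F K)]
  · rw [hM] at hη
    exact linearIndependent_row_of_submatrix_det_ne_zero hη

/-- Tensoring with a fixed vector, as a linear map. -/
def tensorWith {K : Type*} [Field K] {d : ℕ} (r : ℕ) (y : Fin d → K) :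
    (Fin r → K) →ₗ[K] (Fin r × Fin d → K) where
  toFun x := tensorRow x y
  map_add' x x' := tensorRow_add_left x x' y
  map_smul' a x := tensorRow_smul_left a x y

/-- The maps `φ` with `φ (x i) ⊥ η i` for all `i` form a vector space, on which none of the
functionals `φ ↦ φ (x i) j₀` vanishes identically; over an infinite field some `φ` avoids all
their kernels. -/
theorem exists_linearMap_of_augmentedRows {K ι : Type*} [Field K] [Infinite K] [Finite ι]
    {r d : ℕ} {x : ι → Fin r → K} {η : ι → Fin d → K} {j₀ : Fin d}
    (h : ∀ i₀, LinearIndependent K (augmentedRows x i₀ j₀ η)) :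
    ∃ φ : (Fin r → K) →ₗ[K] (Fin d → K),
      ∀ i, ∑ j, φ (x i) j * η i j = 0 ∧ φ (x i) j₀ ≠ 0 := by
  set U := Submodule.span K (Set.range fun i => tensorRow (x i) (η i)) with hU
  obtain ⟨f, hf, hne⟩ := Module.Dual.exists_forall_mem_ne_zero_of_forall_exists
    U.dualAnnihilator (fun i => Module.Dual.eval K _ (tensorRow (x i) (Pi.single j₀ 1))) (by
      intro i
      have h1 := (linearIndependent_option.mp (h i)).2
      obtain ⟨f, hf, hle⟩ := Submodule.exists_le_ker_of_notMem h1
      refine ⟨f, ?_, hf⟩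
      rw [Submodule.mem_dualAnnihilator]
      exact fun w hw => hle hw)
  refine ⟨LinearMap.pi fun j => f ∘ₗ tensorWith r (Pi.single j 1), fun i => ⟨?_, hne i⟩⟩
  have h1 := (Submodule.mem_dualAnnihilator f).mp hf _ (Submodule.subset_span ⟨i, rfl⟩)
  simp only at h1
  rw [tensorRow_eq_sum, map_sum] at h1
  rw [← h1]
  refine Finset.sum_congr rfl fun j _ => ?_
  rw [map_smul, smul_eq_mul, mul_comm]
  rfl

/-- A property of tuples of subspaces that holds wherever a nonzero polynomial in the entries of
spanning matrices does not vanish holds on a Zariski dense set. -/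
theorem dense_of_polynomial {K ι : Type*} [Field K] [Infinite K] [Finite ι] {k d : ℕ}
    {S : Set (GrProd ι K k d)} {P : MvPolynomial (ι × Fin k × Fin d) K} (hP : P ≠ 0)
    (h : ∀ (B : ι → Fin k → Fin d → K) (hB : ∀ i, LinearIndependent K (B i)),
      eval (fun q => B q.1 q.2.1 q.2.2) P ≠ 0 → (fun i => rowSpan (B i) (hB i)) ∈ S) :
    Dense S := by
  classical
  have := Fintype.ofFinite ι
  rw [(TopologicalSpace.isTopologicalBasis_of_subbasis
    (t := zariskiTopology ι K k d) rfl).dense_iff]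
  rintro _ ⟨f, ⟨hfin, hf⟩, rfl⟩ ⟨W, hW⟩
  have := hfin.fintype
  -- each subbasic open set contains all markings off the zero locus of some polynomial in `B`
  have hQ : ∀ U : f, ∃ Q : MvPolynomial (ι × Fin k × Fin d) K, Q ≠ 0 ∧
      ∀ (B : ι → Fin k → Fin d → K) (hB : ∀ i, LinearIndependent K (B i)),
        eval (fun q => B q.1 q.2.1 q.2.2) Q ≠ 0 →
          (fun i => rowSpan (B i) (hB i) : GrProd ι K k d) ∈ (U : Set (GrProd ι K k d)) := by
    rintro ⟨U, hU⟩
    obtain ⟨g, D, -, rfl⟩ := hf hU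
    obtain ⟨b, hb⟩ := hW _ hU
    let Q : MvPolynomial (ι × Fin k × Fin d) K :=
      bind₁ (fun p => minors (fun a j => X (p.1, a, j)) p.2) g
    have hQ : ∀ B : ι → Fin k → Fin d → K, eval (fun q => B q.1 q.2.1 q.2.2) Q =
        eval (fun p => minors (B p.1) p.2) g := by
      intro B
      have : ∀ p : ι × (Fin k ↪o Fin d), eval (fun q => B q.1 q.2.1 q.2.2)
          (minors (fun a j => (X (p.1, a, j) : MvPolynomial (ι × Fin k × Fin d) K)) p.2) =
          minors (B p.1) p.2 := by
        intro p
        rw [minors, RingHom.map_det, minors]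
        congr 1
        ext a c
        simp
      simp only [Q, ← this]
      exact eval₂Hom_bind₁ _ _ _ _
    refine ⟨Q, ?_, fun B hB hne => ⟨fun i => Basis.span (hB i), ?_⟩⟩
    · intro h0
      have := hQ (fun i a => (b i a : Fin d → K))
      rw [h0, map_zero] at this
      exact hb this.symm
    · rw [hQ] at hne
      simp only [plucker_basisSpan]
      exact hne
  choose Q hQ0 hQ using hQ
  -- a minor of a basis of `W i` guarantees that the rows of a generic matrix are independent
  have hL : ∀ i : ι, ∃ L : MvPolynomial (ι × Fin k × Fin d) K, L ≠ 0 ∧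
      ∀ B : ι → Fin k → Fin d → K, eval (fun q => B q.1 q.2.1 q.2.2) L ≠ 0 →
        LinearIndependent K (B i) := by
    intro i
    have hfr : finrank K (W i).1 = k := (W i).2
    have : FiniteDimensional K (W i).1 := inferInstance
    let b := finBasisOfFinrankEq K (W i).1 hfr
    have hb : LinearIndependent K (fun a => (b a : Fin d → K)) :=
      b.linearIndependent.map' (W i).1.subtype (Submodule.ker_subtype _)
    obtain ⟨e, he⟩ := exists_submatrix_det_ne_zero (Matrix.of fun a => (b a : Fin d → K)) hb
    let L : MvPolynomial (ι × Fin k × Fin d) K :=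
      (Matrix.of fun a c : Fin k => (X (i, a, e c) : MvPolynomial (ι × Fin k × Fin d) K)).det
    have hL : ∀ B : ι → Fin k → Fin d → K, eval (fun q => B q.1 q.2.1 q.2.2) L =
        ((Matrix.of (B i)).submatrix id e).det := by
      intro B
      rw [RingHom.map_det]
      congr 1
      ext a c
      simp
    refine ⟨L, fun h0 => ?_, fun B hB => ?_⟩
    · have := hL (fun _ a => (b a : Fin d → K))
      rw [h0, map_zero] at this
      exact he this.symm
    · rw [hL] at hB
      exact linearIndependent_row_of_submatrix_det_ne_zero hB
  choose L hL0 hL using hL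
  obtain ⟨x, hx⟩ := exists_eval_ne_zero (P := P * (∏ i, L i) * ∏ U, Q U)
    (mul_ne_zero (mul_ne_zero hP (Finset.prod_ne_zero_iff.mpr fun i _ => hL0 i))
      (Finset.prod_ne_zero_iff.mpr fun U _ => hQ0 U))
  let B : ι → Fin k → Fin d → K := fun i a j => x (i, a, j)
  simp only [map_mul, map_prod, mul_ne_zero_iff, Finset.prod_ne_zero_iff] at hx
  obtain ⟨⟨hx1, hx2⟩, hx3⟩ := hx
  have hB : ∀ i, LinearIndependent K (B i) := fun i => hL i B (hx2 i (Finset.mem_univ _))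
  exact ⟨fun i => rowSpan (B i) (hB i),
    fun U hU => hQ ⟨U, hU⟩ B hB (hx3 _ (Finset.mem_univ _)), h B hB hx1⟩

/-- A hyperplane given by a spanning matrix is the orthogonal complement of the vector of maximal
minors. -/
theorem mem_rowSpan_of_sum_mul_normalVec {K : Type*} [Field K] {k : ℕ}
    {B : Fin k → Fin (k + 1) → K} (hB : LinearIndependent K B)
    {T : Fin (k + 1) ↪o Fin (k + 1)} (hT : normalVec T (minors B) ≠ 0)
    {w : Fin (k + 1) → K} (hw : ∑ j, w j * normalVec T (minors B) j = 0) :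
    w ∈ (rowSpan B hB).1 := by
  let ℓ : Module.Dual K (Fin (k + 1) → K) :=
    ∑ j, normalVec T (minors B) j • LinearMap.proj j
  have hℓ : ∀ w, ℓ w = ∑ j, w j * normalVec T (minors B) j := by
    intro w
    simp [ℓ, LinearMap.sum_apply, mul_comm]
  have hℓ0 : ℓ ≠ 0 := by
    intro h0
    apply hT
    ext j
    have := hℓ (Pi.single j 1)
    rw [h0] at this
    simpa [Pi.single_apply] using this.symm
  have hle : (rowSpan B hB).1 ≤ LinearMap.ker ℓ := by
    refine Submodule.span_le.mpr ?_
    rintro _ ⟨a, rfl⟩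
    rw [SetLike.mem_coe, LinearMap.mem_ker, hℓ, sum_mul_normalVec]
  have hker := Module.Dual.finrank_ker_add_one_of_ne_zero hℓ0
  rw [Submodule.eq_of_le_of_finrank_eq hle (by
    rw [(rowSpan B hB).2]
    simp at hker
    omega)]
  rw [LinearMap.mem_ker, hℓ, hw]

/-- For markings by generic hyperplanes, the vectors of signed minors of the spanning matrices play
the role of generic normals. -/
theorem IsLaman.slopeIndependent {F K ι : Type*} [Field F] [Field K] [Algebra F K] [Infinite K]
    [Finite ι] {r k : ℕ} (hk : 0 < k) {v : ι → Fin r → F} (h : IsLaman (k + 1) v) :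
    SlopeIndependent K k (k + 1) v := by
  classical
  have := Fintype.ofFinite ι
  choose c P hPc hP using fun i₀ => h.exists_polynomial K i₀ (Fin.last k)
  let T : Fin (k + 1) ↪o Fin (k + 1) := RelEmbedding.refl _
  let Q : ι → MvPolynomial (ι × Fin k × Fin (k + 1)) K := fun i₀ =>
    bind₁ (fun q => normalVec T (minors (fun a j => X (q.1, a, j))) q.2) (P i₀)
  have hQ : ∀ i₀ (B : ι → Fin k → Fin (k + 1) → K),
      eval (fun q => B q.1 q.2.1 q.2.2) (Q i₀) =
      eval (fun q => normalVec T (minors (B q.1)) q.2) (P i₀) := by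
    intro i₀ B
    have : ∀ q : ι × Fin (k + 1), eval (fun q => B q.1 q.2.1 q.2.2) (normalVec T (minors
        (fun a j => (X (q.1, a, j) : MvPolynomial (ι × Fin k × Fin (k + 1)) K))) q.2) =
        normalVec T (minors (B q.1)) q.2 := by
      intro q
      rw [normalVec_map]
      congr 1
      ext S
      rw [minors, RingHom.map_det, minors]
      congr 1
      ext a c
      simp
    simp only [Q, ← this]
    exact eval₂Hom_bind₁ _ _ _ _
  have hQ0 : ∀ i₀, Q i₀ ≠ 0 := by
    intro i₀ h0
    choose B hB using fun i => exists_normalVec_eq_single (R := K) hk T (c i₀ i)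
    have := hQ i₀ B
    rw [h0, map_zero] at this
    simp only [hB] at this
    exact hPc i₀ this.symm
  refine dense_of_polynomial (Finset.prod_ne_zero_iff.mpr fun i₀ (_ : i₀ ∈ Finset.univ) => hQ0 i₀)
    fun B hB hne => ?_
  simp only [map_prod, Finset.prod_ne_zero_iff, hQ] at hne
  have haug := fun i₀ => hP i₀ (fun i => normalVec T (minors (B i))) (hne i₀ (Finset.mem_univ _))
  obtain ⟨φ, hφ⟩ := exists_linearMap_of_augmentedRows haug
  refine ⟨(φ, fun i => rowSpan (B i) (hB i)), ⟨fun i => ?_, fun i h0 => (hφ i).2 ?_⟩, rfl⟩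
  · refine mem_rowSpan_of_sum_mul_normalVec (hB i) (fun h0 => ?_) (hφ i).1
    apply (haug i).ne_zero (some i)
    simp only [augmentedRows, h0]
    ext p
    simp [tensorRow]
  · exact congrFun h0 _

/-- The infinite field `K` only serves to find a point at which the rows, cleared of denominators,
specialize to independent ones. -/
theorem IsLaman.linearIndependent_hyperplaneMatrix (K : Type*) {F ι : Type*} [Field F] [Field K] [Algebra F K]
    [Infinite K] [Finite ι] {r k : ℕ} {v : ι → Fin r → F} {A : Set ι}
    (h : IsLaman (k + 1) (fun i : A => v i)) :
    LinearIndependent (MarkedField F ι r (k + 1))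
      (fun i : A => hyperplaneMatrix (k + 1) v i) := by
  classical
  have := Fintype.ofFinite A
  rcases isEmpty_or_nonempty A with hA | ⟨⟨i₁⟩⟩
  · exact linearIndependent_empty_type
  choose c P hPc hP using fun i₀ => h.exists_polynomial K i₀ (Fin.last k)
  obtain ⟨x, hx⟩ := exists_eval_ne_zero (P := ∏ i₀, P i₀) (Finset.prod_ne_zero_iff.mpr
    fun i₀ _ h0 => hPc i₀ (by rw [h0, map_zero]))
  simp only [map_prod, Finset.prod_ne_zero_iff] at hx
  set η : A → Fin (k + 1) → K := fun i j => x (i, j) with hη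
  have haug := fun i₀ => hP i₀ η (hx i₀ (Finset.mem_univ _))
  obtain ⟨φ, hφ⟩ := exists_linearMap_of_augmentedRows haug
  have hli : LinearIndependent K (fun i : A => tensorRow (extendScalars K (v i)) (η i)) :=
    (linearIndependent_option.mp (haug i₁)).1
  let g : (Fin (k + 1) × Fin r) ⊕ (ι × Fin (k + 1 - 1)) → K :=
    Sum.elim (fun q => φ (Pi.single q.2 1) q.1)
      (fun q => if hq : q.1 ∈ A then η ⟨q.1, hq⟩ (Fin.castSucc q.2) else 0)
  let lf : A → Fin (k + 1) → MvPolynomial ((Fin (k + 1) × Fin r) ⊕ (ι × Fin (k + 1 - 1))) F :=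
    fun i j => linForm (fun a => Sum.inl (j, a)) (v i)
  -- the rows `η i`, multiplied by the last coordinate of `φ (v i)` to clear denominators
  let y : A → Fin (k + 1) → MvPolynomial ((Fin (k + 1) × Fin r) ⊕ (ι × Fin (k + 1 - 1))) F :=
    fun i => Fin.lastCases (-∑ l : Fin k, X (Sum.inr ((i : ι), l)) * lf i l.castSucc)
      (fun l : Fin k => X (Sum.inr ((i : ι), l)) * lf i (Fin.last k))
  let Z : Matrix A (Fin r × Fin (k + 1))
      (MvPolynomial ((Fin (k + 1) × Fin r) ⊕ (ι × Fin (k + 1 - 1))) F) :=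
    Matrix.of fun i p => C (v i p.1) * y i p.2
  have hlf : ∀ i j, eval₂Hom (algebraMap F K) g (lf i j) = φ (extendScalars K (v i)) j :=
    fun i j => eval₂Hom_linForm φ g _ j (fun _ => rfl) _
  have hy : ∀ i j, eval₂Hom (algebraMap F K) g (y i j) =
      φ (extendScalars K (v i)) (Fin.last k) * η i j := by
    intro i j
    have hX : ∀ l : Fin k, eval₂Hom (algebraMap F K) g (X (Sum.inr ((i : ι), l))) =
        η i l.castSucc := by
      intro l
      rw [eval₂Hom_X']
      simp [g]
    induction j using Fin.lastCases with
    | last =>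
      have h0 := (hφ i).1
      rw [Fin.sum_univ_castSucc] at h0
      simp only [y, Fin.lastCases_last, map_neg, map_sum, map_mul, hX, hlf]
      rw [neg_eq_iff_add_eq_zero, ← h0]
      congr 1
      exact Finset.sum_congr rfl fun l _ => mul_comm _ _
    | cast l =>
      simp only [y, Fin.lastCases_castSucc, map_mul, hX, hlf]
      rw [mul_comm]
  have hZ := linearIndependent_of_specialization (eval₂Hom (algebraMap F K) g)
    (algebraMap _ (MarkedField F ι r (k + 1))) (IsFractionRing.injective _ _) Z (by
      convert hli.units_smul (fun i => Units.mk0 _ (hφ i).2) using 1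
      ext i p
      simp only [Z, Matrix.row, Matrix.map_apply, Matrix.of_apply, Pi.smul_apply',
        Units.smul_mk0, Pi.smul_apply, smul_eq_mul, tensorRow]
      rw [map_mul, eval₂Hom_C, hy]
      simp only [extendScalars]
      ring)
  have hv : ∀ i : A, v i ≠ 0 := fun i => ne_zero_of_tensorRow_ne_zero (hli.ne_zero i)
  have hne : ∀ i : A, markedImage (k + 1) v i (Fin.last k) ≠ 0 := fun i =>
    markedImage_ne_zero (hv i) _
  have halg : ∀ i j, algebraMap _ (MarkedField F ι r (k + 1)) (y i j) =
      markedImage (k + 1) v i (Fin.last k) * genericNormal (k + 1) v i j := by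
    intro i j
    induction j using Fin.lastCases with
    | last =>
      simp only [y, Fin.lastCases_last, map_neg, map_sum, map_mul, lf, ← markedImage_eq,
        genericNormal, Fin.val_last, add_tsub_cancel_right, lt_self_iff_false, dite_false]
      rw [mul_div_cancel₀ _ (hne i)]
      rfl
    | cast l =>
      simp only [y, Fin.lastCases_castSucc, map_mul, lf, ← markedImage_eq]
      rw [mul_comm]
      simp [genericNormal]
  have heq : (fun i : A => hyperplaneMatrix (k + 1) v i) =
      (fun i : A => (Units.mk0 _ (hne i))⁻¹) •
        (Z.map (algebraMap _ (MarkedField F ι r (k + 1)))).row := by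
    ext i p
    change extendScalars (MarkedField F ι r (k + 1)) (v i) p.1 * genericNormal (k + 1) v i p.2 =
      (markedImage (k + 1) v i (Fin.last k))⁻¹ * algebraMap _ _ (C (v i p.1) * y i p.2)
    rw [map_mul, halg, mul_left_comm, inv_mul_cancel_left₀ (hne i), extendScalars,
      IsScalarTower.algebraMap_apply F
        (MvPolynomial ((Fin (k + 1) × Fin r) ⊕ (ι × Fin (k + 1 - 1))) F)
        (MarkedField F ι r (k + 1))]
    rfl
  rw [heq]
  exact hZ.units_smul _

end MatroidRigidity

end

theorem mainTheorem1 {F : Type*} [Field F] {ι : Type*} [Finite ι] {r : ℕ} (v : ι → Fin r → F)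
    (d : ℕ) (hd : 1 < d) (K : Type*) [Field K] [Algebra F K] [Infinite K] :
    MatroidRigidity.slopeComplex K 1 d v ⊆ MatroidRigidity.rigidityComplex d v ∧
    MatroidRigidity.rigidityComplex d v ⊆
      MatroidRigidity.lamanComplex (MatroidRigidity.vectorMatroid F v) (d : ℝ) ∧
    MatroidRigidity.lamanComplex (MatroidRigidity.vectorMatroid F v) (d : ℝ) =
      MatroidRigidity.hyperplaneComplex d v ∧
    MatroidRigidity.hyperplaneComplex d v = MatroidRigidity.slopeComplex K (d - 1) d v := by
  have hLH : MatroidRigidity.lamanComplex (MatroidRigidity.vectorMatroid F v) (d : ℝ) =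
      MatroidRigidity.hyperplaneComplex d v := by
    ext A
    rw [MatroidRigidity.mem_lamanComplex_iff, MatroidRigidity.mem_hyperplaneComplex_iff]
    refine ⟨fun h => ?_, MatroidRigidity.isLaman_of_hyperplaneMatrix (by omega)⟩
    obtain ⟨k, rfl⟩ : ∃ k, d = k + 1 := ⟨d - 1, by omega⟩
    exact h.linearIndependent_hyperplaneMatrix K
  refine ⟨fun A hA => ?_, fun A hA => ?_, hLH, ?_⟩
  · rw [MatroidRigidity.mem_rigidityComplex_iff]
    exact MatroidRigidity.SlopeIndependent.linearIndependent_rigidityMatrix (K := K) hd hA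
  · rw [MatroidRigidity.mem_rigidityComplex_iff] at hA
    rw [MatroidRigidity.mem_lamanComplex_iff]
    exact MatroidRigidity.isLaman_of_rigidityMatrix hd hA
  · rw [← hLH]
    ext A
    rw [MatroidRigidity.mem_lamanComplex_iff]
    obtain ⟨k, rfl⟩ : ∃ k, d = k + 1 := ⟨d - 1, by omega⟩
    exact ⟨fun h => h.slopeIndependent (by omega), fun h =>
      MatroidRigidity.SlopeIndependent.isLaman (K := K) (by omega) (by omega) h⟩
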